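/- **Lemma 6.8 (lemma:invertibility).** Let $M>0$, $|a|\le M$ and $r_+=M+\sqrt{M^2-a^2}$. Let $(\theta,\phi)$ be the standard coordinates on the sphere, $d\Omega=\sin\theta\,d\theta\,d\phi$, $Z=\partial_\phi$, and $$\mathring{\slashed\triangle}^{[-1]}=-\frac1{\sin\theta}\partial_\theta(\sin\theta\,\partial_\theta)-\frac1{\sin^2\theta}Z^2+2i\frac{\cos\theta}{\sin^2\theta}Z+\cot^2\theta,$$ $$\mathring{\slashed\triangle}^{[-1]}_{\mathcal H}=\mathring{\slashed\triangle}^{[-1]}+1+\frac{a^2}{Mr_+}\Big(1-\frac{a^2}{4Mr_+}\sin^2\theta\Big)Z^2+\frac{a}{Mr_+}\,(r_++ia\cos\theta)\,Z .$$ Regard $\mathring{\slashed\triangle}^{[-1]}_{\mathcal H}$ as an unbounded operator on the complex Hilbert space $L^2(d\Omega)$, namely the closure of its action on smooth functions of spin weight $-1$ (functions $f(\theta,\phi)$ on the sphere minus its poles such that $e^{-i\phi}f$ extends smoothly across the north pole $\theta=0$ and $e^{i\phi}f$ extends smoothly across the south pole $\theta=\pi$). Then this closure is a well-defined (single-valued)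 operator, and it is invertible: it is a bijection from its domain onto $L^2(d\Omega)$, with an inverse that is bounded on $L^2(d\Omega)$ with norm at most $2$. All its eigenvalues $\lambda\in\mathbb C$ satisfy $|\lambda|\ge\frac12$. Both bounds hold for every $|a|\le M$ and, for the eigenvalues, for every azimuthal mode number and every eigenvalue within that mode. -/

import Mathlib

open MeasureTheory Set
open scoped Real ContDiff ENNReal

namespace KerrHorizon

noncomputable section

/-- The radius `r₊ = M + √(M² - a²)` of the event horizon of the Kerr black hole with mass `M` and
specific angular momentum `a`, where `|a| ≤ M`. -/
def rPlus (M a : ℝ) : ℝ := M + √(M ^ 2 - a ^ 2)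

/-- The measure `dΩ = sin θ dθ dφ` of the unit round sphere, in the standard coordinates
`(θ, φ) ∈ (0, π) × (0, 2π]`, which miss only the two poles. -/
def sphereMeasure : Measure (ℝ × ℝ) :=
  ((volume.restrict (Ioo 0 π)).withDensity fun θ => ENNReal.ofReal (Real.sin θ)).prod
    (volume.restrict (Ioc 0 (2 * π)))

/-- The complex Hilbert space `L²(dΩ)`. -/
abbrev SphereL2 : Type := Lp ℂ 2 sphereMeasure

/-- The azimuthal vector field `Z = ∂_φ`. -/
def Z (f : ℝ → ℝ → ℂ) (θ φ : ℝ) : ℂ := deriv (fun t => f θ t) φ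

/-- The polar derivative `∂_θ`. -/
def dTheta (f : ℝ → ℝ → ℂ) (θ φ : ℝ) : ℂ := deriv (fun t => f t φ) θ

/-- The spin-`s`-weighted spherical Laplacian
`-(1/sin θ) ∂_θ (sin θ ∂_θ) - (1/sin² θ) Z² - 2 i s (cos θ/sin² θ) Z + s² cot² θ`. -/
def spinLaplacian (s : ℤ) (f : ℝ → ℝ → ℂ) (θ φ : ℝ) : ℂ :=
  -(1 / (Real.sin θ : ℂ)) * dTheta (fun t p => (Real.sin t : ℂ) * dTheta f t p) θ φ
    - 1 / (Real.sin θ : ℂ) ^ 2 * Z (Z f) θ φ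
    - 2 * Complex.I * s * ((Real.cos θ : ℂ) / (Real.sin θ : ℂ) ^ 2) * Z f θ φ
    + (s : ℂ) ^ 2 * ((Real.cos θ : ℂ) / (Real.sin θ : ℂ)) ^ 2 * f θ φ

/-- The horizon spin `-1` angular operator, as a differential expression in `(θ, φ)`:
the spin-weighted Laplacian of spin `-1`, plus `1`, plus
`(a²/(M r₊)) (1 - (a²/(4 M r₊)) sin² θ) Z² + (a/(M r₊)) (r₊ + i a cos θ) Z`. -/
def horizonExpr (M a : ℝ) (f : ℝ → ℝ → ℂ) (θ φ : ℝ) : ℂ :=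
  spinLaplacian (-1) f θ φ + f θ φ
    + ((a ^ 2 / (M * rPlus M a) *
        (1 - a ^ 2 / (4 * M * rPlus M a) * Real.sin θ ^ 2) : ℝ) : ℂ) * Z (Z f) θ φ
    + ((a / (M * rPlus M a) : ℝ) : ℂ) *
        ((rPlus M a : ℂ) + Complex.I * a * Real.cos θ) * Z f θ φ

/-- Smooth spin-`s`-weighted functions on the sphere: `e^{isφ} f` extends smoothly across the
north pole and `e^{-isφ} f` extends smoothly across the south pole. The extensions are written in
the stereographic coordinates `tan(θ/2) e^{iφ}`, which identify the sphere minus the south pole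
with `ℂ`, and `cot(θ/2) e^{iφ}`, which identify the sphere minus the north pole with `ℂ`.
Smoothness is that of functions of two real variables. -/
def IsSmoothSpinWeighted (s : ℤ) (f : ℝ → ℝ → ℂ) : Prop :=
  ∃ gN gS : ℂ → ℂ, ContDiff ℝ ∞ gN ∧ ContDiff ℝ ∞ gS ∧
    ∀ θ ∈ Ioo 0 π, ∀ φ : ℝ,
      Complex.exp (Complex.I * s * φ) * f θ φ =
          gN ((Real.tan (θ / 2) : ℂ) * Complex.exp (Complex.I * φ)) ∧
      Complex.exp (-(Complex.I * s * φ)) * f θ φ =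
          gS (((Real.tan (θ / 2))⁻¹ : ℂ) * Complex.exp (Complex.I * φ))

/-- The graph of the horizon operator acting on smooth functions of spin weight `-1`: the pairs
`(u, h)` in `L²(dΩ) × L²(dΩ)` for which `u` is (the class of) a smooth spin-`(-1)`-weighted
function `f`, and `h` is (the class of) the horizon differential expression applied to `f`. -/
def smoothGraph (M a : ℝ) : Set (SphereL2 × SphereL2) :=
  {p | ∃ f : ℝ → ℝ → ℂ, IsSmoothSpinWeighted (-1) f ∧
    (p.1 =ᵐ[sphereMeasure] fun x => f x.1 x.2) ∧
    (p.2 =ᵐ[sphereMeasure] fun x => horizonExpr M a f x.1 x.2)}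

/-- The graph of the horizon operator as a closed unbounded operator on `L²(dΩ)`: the closure of
the operator acting on smooth functions of spin weight `-1`. -/
def horizonGraph (M a : ℝ) : Set (SphereL2 × SphereL2) := closure (smoothGraph M a)

end

end KerrHorizon

/-! The operator commutes with rotations about the axis, so it splits into azimuthal modes
`e^{imφ}`. Spin weight `-1` forces vanishing orders `p = |m - 1|` and `q = |m + 1|` at the poles;
with `x = cos θ`, the test functions in mode `m` are `e^{imφ} sin(θ/2)^p cos(θ/2)^q P(x)` with `P` a
polynomial. On `P` the operator is a Sturm-Liouville operator plus multiplication by a polynomial.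
Write `l = max |m| 1` and `α = a²/(M r₊)`.

Coercivity (`horizonPoly_form_bound`): the quadratic form on mode `m` has imaginary part `(a m / M)
‖u‖²`, coming from the `r₊ Z` term. If `m ≠ 0` and `|a| > M/2`, this alone has modulus at least
`‖u‖²/2`. Otherwise the real part suffices: for `m = 0` its potential is `l(l+1) = 2`, and for `|a|
≤ M/2` one has `α ≤ 1/4` and the potential is at least `(1 - α) l(l+1) ≥ 3/2`. So `‖u‖ ≤ 2 ‖Hu‖` on
each mode, and on finite sums of modes by orthogonality.

Dense range: the Sturm-Liouville part preserves the degree of `P` and the remaining term is bounded,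
so coercivity and a Galerkin argument (`inner_eq_zero_of_galerkin`) show that a vector orthogonal to
the range is orthogonal to every mode. The modes are total by Stone-Weierstrass
(`eq_zero_of_inner_modeL2_eq_zero`). Hence the inverse on finite sums extends to a bounded `R` of
norm at most `2` whose graph lies in the closure.

Nothing else lies in the closure: Green's identity identifies the formal adjoint as the operator
with `-a`, so pairs in the graph satisfy `⟨mode, h⟩ = ⟨H₋ₐ mode, u⟩`
(`inner_modeL2_of_mem_horizonGraph`). Totality of the modes then gives single-valuedness, and
density of the range of `H₋ₐ` gives `u = R h`. The eigenvalue bound is read off from `‖R‖ ≤ 2`. -/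

namespace KerrHorizon

/-! ### Coercive forms, Galerkin approximation and bounded inverses. -/

section Abstract

variable {E V : Type*} [NormedAddCommGroup E] [InnerProductSpace ℂ E]
  [AddCommGroup V] [Module ℂ V]

/-- Galerkin's argument: a vector orthogonal to the range of a coercive operator `D + B`, with `B`
bounded and `D` preserving an exhaustion by finite-dimensional subspaces, is orthogonal to its
domain. -/
theorem inner_eq_zero_of_galerkin [CompleteSpace E] (ι : V →ₗ[ℂ] E) (D B : V →ₗ[ℂ] V)
    (K : ℕ → Submodule ℂ V) (hKmono : Monotone K) (hKfin : ∀ n, FiniteDimensional ℂ (K n))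
    (hKtop : ∀ x, ∃ n, x ∈ K n) (hD : ∀ n, ∀ x ∈ K n, D x ∈ K n)
    (C δ : ℝ) (hδ : 0 < δ) (hB : ∀ x, ‖ι (B x)‖ ≤ C * ‖ι x‖)
    (hform : ∀ x, δ * ‖ι x‖ ^ 2 ≤ ‖inner ℂ (ι x) (ι (D x + B x))‖)
    (v : E) (hv : ∀ x, inner ℂ v (ι (D x + B x)) = 0) (x : V) : inner ℂ v (ι x) = 0 := by
  let S : ℕ → Submodule ℂ E := fun n => (K n).map ι
  have hfin : ∀ n, FiniteDimensional ℂ (S n) := fun n => by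
    have := hKfin n
    infer_instance
  have hmono : Monotone S := fun m n h => Submodule.map_mono (hKmono h)
  let W : Submodule ℂ E := (⨆ n, S n).topologicalClosure
  have hcomplete : CompleteSpace W := (⨆ n, S n).isClosed_topologicalClosure.completeSpace_coe
  have hmem : ∀ y, ι y ∈ W := fun y => by
    obtain ⟨n, hn⟩ := hKtop y
    exact Submodule.le_topologicalClosure _
      ((le_iSup S n) (Submodule.mem_map_of_mem hn))
  have hlim := Submodule.starProjection_tendsto_closure_iSup S hmono v
  set w : E := W.starProjection v with hw
  have hproj : ∀ y, inner ℂ v (ι y) = inner ℂ w (ι y) := fun y => by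
    have := W.starProjection_inner_eq_zero v (ι y) (hmem y)
    rw [inner_sub_left] at this
    exact sub_eq_zero.mp this
  -- With `ι y` the projection of `v` to level `n`, `ι (D y)` stays in that level, so `⟨ι y, ι (D
  -- y)⟩ = ⟨v, ι (D y)⟩ = -⟨v, ι (B y)⟩`. The unbounded part `D` thus disappears, and the form
  -- equals `⟨ι y - w, ι (B y)⟩`, which tends to zero.
  have key : ∀ n, δ * ‖(S n).starProjection v‖ ^ 2 ≤
      ‖(S n).starProjection v - w‖ * (C * ‖(S n).starProjection v‖) := fun n => by
    obtain ⟨y, hy, hyv⟩ : ∃ y ∈ K n, ι y = (S n).starProjection v :=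
      Submodule.mem_map.mp ((S n).starProjection_apply_mem v)
    have h1 : inner ℂ (ι y) (ι (D y)) = inner ℂ v (ι (D y)) := by
      have := (S n).starProjection_inner_eq_zero v (ι (D y))
        (Submodule.mem_map_of_mem (hD n y hy))
      rw [inner_sub_left, ← hyv] at this
      exact (sub_eq_zero.mp this).symm
    have h2 : inner ℂ (ι y) (ι (D y + B y)) = inner ℂ (ι y - w) (ι (B y)) := by
      have h3 := hv y
      rw [map_add, inner_add_right] at h3 ⊢
      rw [h1, inner_sub_left, ← hproj, eq_neg_of_add_eq_zero_left h3]
      ring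
    rw [← hyv]
    calc δ * ‖ι y‖ ^ 2 ≤ _ := hform y
      _ ≤ ‖ι y - w‖ * ‖ι (B y)‖ := by rw [h2]; exact norm_inner_le_norm _ _
      _ ≤ _ := by gcongr; exact hB y
  have h0 : δ * ‖w‖ ^ 2 ≤ ‖w - w‖ * (C * ‖w‖) :=
    le_of_tendsto_of_tendsto' ((hlim.norm.pow 2).const_mul δ)
      ((hlim.sub_const w).norm.mul (hlim.norm.const_mul C)) key
  have hw0 : w = 0 := by
    rw [sub_self, norm_zero, zero_mul] at h0
    have : ‖w‖ ^ 2 = 0 := le_antisymm (by nlinarith) (by positivity)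
    simpa using this
  rw [hproj, hw0, inner_zero_left]

theorem norm_le_of_form_bound (ι : V →ₗ[ℂ] E) (T : V →ₗ[ℂ] V) (δ : ℝ)
    (hform : ∀ x, δ * ‖ι x‖ ^ 2 ≤ ‖inner ℂ (ι x) (ι (T x))‖) (x : V) :
    δ * ‖ι x‖ ≤ ‖ι (T x)‖ := by
  rcases (norm_nonneg (ι x)).eq_or_lt with h | h
  · rw [← h, mul_zero]; positivity
  · have := (hform x).trans (norm_inner_le_norm _ _)
    nlinarith

/-- If `‖ι x‖ ≤ C ‖T x‖` and `T` has dense range, then the closure of `{(ι x, T x)}` is the graph of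
the inverse of a bounded operator. -/
theorem exists_bounded_inverse [CompleteSpace E] (ι T : V →ₗ[ℂ] E) (C : ℝ) (hC : 0 ≤ C)
    (hbound : ∀ x, ‖ι x‖ ≤ C * ‖T x‖) (hdense : DenseRange T) :
    ∃ R : E →L[ℂ] E, ‖R‖ ≤ C ∧ (∀ x, R (T x) = ι x) ∧
      ∀ h, (R h, h) ∈ closure (range fun x => (ι x, T x)) := by
  refine ⟨ι.extendOfNorm T, LinearMap.opNorm_extendOfNorm_le hdense hC hbound,
    LinearMap.extendOfNorm_eq hdense ⟨C, hbound⟩, fun h => ?_⟩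
  have hcont : Continuous fun k : E => (ι.extendOfNorm T k, k) := by fun_prop
  refine (hdense.induction_on (p := fun k => (ι.extendOfNorm T k, k) ∈
    closure (range fun x => (ι x, T x))) h (isClosed_closure.preimage hcont) fun x => ?_)
  rw [LinearMap.extendOfNorm_eq hdense ⟨C, hbound⟩]
  exact subset_closure ⟨x, rfl⟩

end Abstract

noncomputable section

open Polynomial

/-! ### The Sturm-Liouville operator on the polynomial part of a mode. -/

section Poly

/-- The order of vanishing at the north pole of the functions of azimuthal mode `m`. -/
def northOrder (m : ℤ) : ℕ := (m - 1).natAbs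

/-- The order of vanishing at the south pole of the functions of azimuthal mode `m`. -/
def southOrder (m : ℤ) : ℕ := (m + 1).natAbs

/-- The lowest angular momentum `max |m| 1` of the functions of azimuthal mode `m`. -/
def lowestSpin (m : ℤ) : ℕ := max m.natAbs 1

theorem northOrder_add_southOrder (m : ℤ) : northOrder m + southOrder m = 2 * lowestSpin m := by
  unfold northOrder southOrder lowestSpin; omega

/-- The weight `((1 - x)/2)^p ((1 + x)/2)^q` of the scalar product of the mode `m` in the variable
`x = cos θ`. -/
def weight (m : ℤ) : ℂ[X] :=
  C ((1 / 2) ^ (northOrder m + southOrder m)) * (1 - X) ^ northOrder m * (1 + X) ^ southOrder m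

/-- The polynomial `A` for which `sin θ ∂_θ` acts on the mode `m` as `A - (1 - x²) ∂_x`. -/
def driftPoly (m : ℤ) : ℂ[X] :=
  C (((northOrder m : ℂ) - southOrder m) / 2) + C (((northOrder m : ℂ) + southOrder m) / 2) * X

/-- The spin `-1` Laplacian plus `1`, acting on the polynomial part of the mode `m`. -/
def laplacianPoly (m : ℤ) : ℂ[X] →ₗ[ℂ] ℂ[X] :=
  LinearMap.mulLeft ℂ (C ((lowestSpin m : ℂ) * (lowestSpin m + 1))) +
    (LinearMap.mulLeft ℂ (2 * driftPoly m)).comp derivative -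
    derivative.comp ((LinearMap.mulLeft ℂ (1 - X ^ 2)).comp derivative)

theorem laplacianPoly_apply (m : ℤ) (P : ℂ[X]) : laplacianPoly m P =
    C ((lowestSpin m : ℂ) * (lowestSpin m + 1)) * P + 2 * driftPoly m * derivative P -
      derivative ((1 - X ^ 2) * derivative P) := rfl

/-- This Pearson equation is what makes the weight symmetrise the operator: it absorbs the
first-order term `2 A P'` into a total derivative. -/
theorem one_sub_sq_mul_derivative_weight (m : ℤ) :
    (1 - X ^ 2) * derivative (weight m) = -(2 * driftPoly m * weight m) := by
  have h1 : (1 - X) * derivative ((1 - X : ℂ[X]) ^ northOrder m) =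
      -((northOrder m : ℂ[X]) * (1 - X) ^ northOrder m) := by
    rcases Nat.eq_zero_or_pos (northOrder m) with h | h
    · simp [h]
    · rw [derivative_pow]
      nth_rw 4 [← Nat.sub_add_cancel h]
      simp only [derivative_sub, derivative_one, derivative_X, map_natCast]
      ring
  have h2 : (1 + X) * derivative ((1 + X : ℂ[X]) ^ southOrder m) =
      (southOrder m : ℂ[X]) * (1 + X) ^ southOrder m := by
    rcases Nat.eq_zero_or_pos (southOrder m) with h | h
    · simp [h]
    · rw [derivative_pow]
      nth_rw 4 [← Nat.sub_add_cancel h]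
      simp only [derivative_add, derivative_one, derivative_X, map_natCast]
      ring
  have h3 : (2 : ℂ[X]) * driftPoly m =
      (northOrder m : ℂ[X]) * (1 + X) - (southOrder m : ℂ[X]) * (1 - X) := by
    have e : (2 : ℂ[X]) = C 2 := rfl
    rw [driftPoly, e, mul_add, ← mul_assoc, ← C_mul, ← C_mul, mul_div_cancel₀ _ (two_ne_zero),
      mul_div_cancel₀ _ (two_ne_zero), C_add, C_sub]
    simp only [map_natCast]
    ring
  rw [h3, weight]
  simp only [derivative_mul, derivative_C, zero_mul, zero_add]
  linear_combination (C ((1 / 2) ^ (northOrder m + southOrder m)) * (1 + X) *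
    (1 + X) ^ southOrder m) * h1 + (C ((1 / 2) ^ (northOrder m + southOrder m)) * (1 - X) *
    (1 - X) ^ northOrder m) * h2

/-- Integration by parts in algebraic form. The total derivative carries a factor `1 - x²`, so it
integrates to zero over `[-1, 1]`, leaving a symmetric, nonnegative form. -/
theorem weight_mul_laplacianPoly (m : ℤ) (P Q : ℂ[X]) : weight m * Q * laplacianPoly m P =
    C ((lowestSpin m : ℂ) * (lowestSpin m + 1)) * (weight m * Q * P) +
      weight m * (1 - X ^ 2) * (derivative Q * derivative P) -
      derivative (weight m * (1 - X ^ 2) * derivative P * Q) := by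
  rw [laplacianPoly_apply]
  simp only [derivative_mul]
  linear_combination (derivative P * Q) * one_sub_sq_mul_derivative_weight m

/-- Each derivative is compensated by a coefficient of at most the same degree. The spaces of
bounded degree are therefore the invariant finite-dimensional exhaustion for Galerkin's argument. -/
theorem laplacianPoly_mem_degreeLT (m : ℤ) (n : ℕ) (P : ℂ[X]) (hP : P ∈ degreeLT ℂ n) :
    laplacianPoly m P ∈ degreeLT ℂ n := by
  rcases n with _ | n
  · have : P = 0 := by simpa [mem_degreeLT] using hP
    simp [this]
  rw [degreeLT_succ_eq_degreeLE, mem_degreeLE, ← natDegree_le_iff_degree_le] at *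
  -- Constants need their own case: the zero polynomial `P'` has `natDegree` `0`, so the product
  -- estimate would only bound the degree of `2 A P'` by `1`.
  rcases n with _ | n
  · obtain ⟨c, rfl⟩ : ∃ c, P = C c := ⟨_, eq_C_of_natDegree_le_zero hP⟩
    rw [laplacianPoly_apply]
    simp only [derivative_C, mul_zero, map_zero, add_zero, sub_zero, ← C_mul, natDegree_C]
    rfl
  · have hd : (derivative P).natDegree ≤ n := (natDegree_derivative_le P).trans (by omega)
    have hA : (2 * driftPoly m).natDegree ≤ 1 := by
      unfold driftPoly
      have e : (2 : ℂ[X]) = C 2 := rfl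
      rw [e]
      compute_degree
    have hX : (1 - X ^ 2 : ℂ[X]).natDegree ≤ 2 := by compute_degree
    rw [laplacianPoly_apply]
    refine (natDegree_sub_le _ _).trans (max_le ((natDegree_add_le _ _).trans (max_le ?_ ?_)) ?_)
    · exact (natDegree_C_mul_le _ _).trans hP
    · exact natDegree_mul_le.trans (by omega)
    · refine (natDegree_derivative_le _).trans ?_
      have := natDegree_mul_le (p := (1 - X ^ 2 : ℂ[X])) (q := derivative P)
      omega

theorem eval_map_conj (P : ℂ[X]) (x : ℝ) :
    (P.map (starRingEnd ℂ)).eval (x : ℂ) = (starRingEnd ℂ) (P.eval (x : ℂ)) := by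
  rw [eval_map, ← eval₂_at_apply, Complex.conj_ofReal]

theorem continuous_eval_cos (P : ℂ[X]) : Continuous fun θ : ℝ => P.eval ((Real.cos θ : ℝ) : ℂ) :=
  P.continuous.comp (Complex.continuous_ofReal.comp Real.continuous_cos)

theorem exists_bound_eval_cos (P : ℂ[X]) :
    ∃ K, 0 ≤ K ∧ ∀ θ : ℝ, ‖P.eval ((Real.cos θ : ℝ) : ℂ)‖ ≤ K := by
  obtain ⟨K, hK⟩ := (isCompact_Icc (a := (-1 : ℝ)) (b := 1)).exists_bound_of_continuousOn
    (f := fun x : ℝ => P.eval (x : ℂ)) (P.continuous.comp Complex.continuous_ofReal).continuousOn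
  refine ⟨K, (norm_nonneg _).trans (hK 0 (by norm_num)), fun θ => ?_⟩
  exact hK _ ⟨Real.neg_one_le_cos θ, Real.cos_le_one θ⟩

theorem integral_derivative_eval_cos (P : ℂ[X]) :
    ∫ θ in (0 : ℝ)..π, (derivative P).eval ((Real.cos θ : ℝ) : ℂ) * (Real.sin θ : ℝ) =
      P.eval 1 - P.eval (-1) := by
  have h : ∀ θ ∈ uIcc 0 π, HasDerivAt (fun θ : ℝ => -P.eval ((Real.cos θ : ℝ) : ℂ))
      ((derivative P).eval ((Real.cos θ : ℝ) : ℂ) * (Real.sin θ : ℝ)) θ := fun θ _ => by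
    have := (P.hasDerivAt ((Real.cos θ : ℝ) : ℂ)).comp θ (Real.hasDerivAt_cos θ).ofReal_comp
    convert! this.neg using 1
    push_cast
    ring
  rw [intervalIntegral.integral_eq_sub_of_hasDerivAt h]
  · simp only [Real.cos_pi, Real.cos_zero, Complex.ofReal_neg, Complex.ofReal_one]
    ring
  · refine Continuous.intervalIntegrable ?_ _ _
    exact (continuous_eval_cos _).mul (Complex.continuous_ofReal.comp Real.continuous_sin)

end Poly

/-! ### The modes as elements of `L²(dΩ)` and their scalar products. -/

section Modes

instance : IsFiniteMeasure sphereMeasure := by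
  have : IsFiniteMeasure ((volume.restrict (Ioo 0 π)).withDensity
      fun θ => ENNReal.ofReal (Real.sin θ)) :=
    isFiniteMeasure_withDensity_ofReal
      ((Real.continuous_sin.integrableOn_Icc (a := 0) (b := π)).mono_set Ioo_subset_Icc_self).2
  unfold sphereMeasure
  infer_instance

theorem integral_sphere_eq_mul {F : ℝ × ℝ → ℂ} (f g : ℝ → ℂ) (hF : ∀ x, F x = f x.1 * g x.2) :
    ∫ x, F x ∂sphereMeasure =
      (∫ θ in (0 : ℝ)..π, f θ * (Real.sin θ : ℝ)) * ∫ φ in (0 : ℝ)..2 * π, g φ := by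
  simp_rw [hF]
  rw [sphereMeasure, integral_prod_mul, intervalIntegral.integral_of_le Real.two_pi_pos.le,
    intervalIntegral.integral_of_le Real.pi_pos.le]
  congr 1
  rw [integral_Ioc_eq_integral_Ioo (x := (0 : ℝ)) (y := π),
    integral_withDensity_eq_integral_toReal_smul (by fun_prop) (by simp)]
  refine integral_congr_ae ?_
  filter_upwards [ae_restrict_mem measurableSet_Ioo] with θ hθ
  simp only [ENNReal.toReal_ofReal (Real.sin_pos_of_mem_Ioo hθ).le, Complex.real_smul]
  ring

/-- The function `e^{imφ} sin(θ/2)^p cos(θ/2)^q P(cos θ)` of spin weight `-1` and azimuthal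
mode `m`. -/
def modeFun (m : ℤ) (P : ℂ[X]) (θ φ : ℝ) : ℂ :=
  Complex.exp (Complex.I * m * φ) * (((Real.sin (θ / 2) : ℝ) : ℂ) ^ northOrder m *
    ((Real.cos (θ / 2) : ℝ) : ℂ) ^ southOrder m * P.eval ((Real.cos θ : ℝ) : ℂ))

theorem modeFun_add (m : ℤ) (P Q : ℂ[X]) (θ φ : ℝ) :
    modeFun m (P + Q) θ φ = modeFun m P θ φ + modeFun m Q θ φ := by
  simp only [modeFun, eval_add]; ring

theorem modeFun_smul (m : ℤ) (c : ℂ) (P : ℂ[X]) (θ φ : ℝ) :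
    modeFun m (c • P) θ φ = c * modeFun m P θ φ := by
  simp only [modeFun, eval_smul, smul_eq_mul]; ring

theorem continuous_modeFun (m : ℤ) (P : ℂ[X]) :
    Continuous fun x : ℝ × ℝ => modeFun m P x.1 x.2 := by
  have := (continuous_eval_cos P).comp (continuous_fst (X := ℝ) (Y := ℝ))
  unfold modeFun
  refine Continuous.mul (by fun_prop) (Continuous.mul ?_ this)
  exact ((Complex.continuous_ofReal.comp (by fun_prop)).pow _).mul
    ((Complex.continuous_ofReal.comp (by fun_prop)).pow _)

theorem norm_exp_mode (m : ℤ) (φ : ℝ) : ‖Complex.exp (Complex.I * m * φ)‖ = 1 := by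
  have : Complex.I * m * φ = ((m * φ : ℝ) : ℂ) * Complex.I := by push_cast; ring
  rw [this, Complex.norm_exp_ofReal_mul_I]

theorem exists_bound_modeFun (m : ℤ) (P : ℂ[X]) : ∃ K, ∀ θ φ, ‖modeFun m P θ φ‖ ≤ K := by
  obtain ⟨K, hK0, hK⟩ := exists_bound_eval_cos P
  refine ⟨K, fun θ φ => ?_⟩
  have h1 : ‖((Real.sin (θ / 2) : ℝ) : ℂ)‖ ^ northOrder m ≤ 1 :=
    pow_le_one₀ (norm_nonneg _) (by rw [Complex.norm_real]; exact Real.abs_sin_le_one _)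
  have h2 : ‖((Real.cos (θ / 2) : ℝ) : ℂ)‖ ^ southOrder m ≤ 1 :=
    pow_le_one₀ (norm_nonneg _) (by rw [Complex.norm_real]; exact Real.abs_cos_le_one _)
  rw [modeFun, norm_mul, norm_exp_mode, one_mul, norm_mul, norm_mul, norm_pow, norm_pow]
  calc _ ≤ 1 * 1 * K := by gcongr; exact hK θ
    _ = K := by ring

theorem memLp_modeFun (m : ℤ) (P : ℂ[X]) :
    MemLp (fun x : ℝ × ℝ => modeFun m P x.1 x.2) 2 sphereMeasure := by
  obtain ⟨K, hK⟩ := exists_bound_modeFun m P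
  exact .of_bound (continuous_modeFun m P).aestronglyMeasurable K (.of_forall fun x => hK _ _)

/-- The class in `L²(dΩ)` of `modeFun m P`. -/
def modeL2 (m : ℤ) : ℂ[X] →ₗ[ℂ] SphereL2 where
  toFun P := (memLp_modeFun m P).toLp _
  map_add' P Q := by
    rw [← MemLp.toLp_add]
    exact MemLp.toLp_congr _ ((memLp_modeFun m P).add (memLp_modeFun m Q))
      (.of_forall fun x => modeFun_add m P Q x.1 x.2)
  map_smul' c P := by
    rw [RingHom.id_apply, ← MemLp.toLp_const_smul]
    exact MemLp.toLp_congr _ ((memLp_modeFun m P).const_smul c)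
      (.of_forall fun x => modeFun_smul m c P x.1 x.2)

theorem coeFn_modeL2 (m : ℤ) (P : ℂ[X]) :
    modeL2 m P =ᵐ[sphereMeasure] fun x => modeFun m P x.1 x.2 :=
  (memLp_modeFun m P).coeFn_toLp

theorem weight_eval_cos (m : ℤ) (θ : ℝ) : (weight m).eval ((Real.cos θ : ℝ) : ℂ) =
    ((Real.sin (θ / 2) : ℝ) : ℂ) ^ northOrder m * ((Real.cos (θ / 2) : ℝ) : ℂ) ^ southOrder m *
    (((Real.sin (θ / 2) : ℝ) : ℂ) ^ northOrder m *
      ((Real.cos (θ / 2) : ℝ) : ℂ) ^ southOrder m) := by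
  have h : Real.cos θ = Real.cos (θ / 2) ^ 2 - Real.sin (θ / 2) ^ 2 := by
    rw [← Real.cos_two_mul', mul_div_cancel₀ _ two_ne_zero]
  have h1 : (1 : ℝ) = Real.cos (θ / 2) ^ 2 + Real.sin (θ / 2) ^ 2 :=
    (Real.cos_sq_add_sin_sq _).symm
  have hs : (1 : ℂ) - (Real.cos θ : ℝ) = 2 * ((Real.sin (θ / 2) : ℝ) : ℂ) ^ 2 := by
    have : (1 : ℝ) - Real.cos θ = 2 * Real.sin (θ / 2) ^ 2 := by linarith
    exact_mod_cast congrArg Complex.ofReal this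
  have hc : (1 : ℂ) + (Real.cos θ : ℝ) = 2 * ((Real.cos (θ / 2) : ℝ) : ℂ) ^ 2 := by
    have : (1 : ℝ) + Real.cos θ = 2 * Real.cos (θ / 2) ^ 2 := by linarith
    exact_mod_cast congrArg Complex.ofReal this
  simp only [weight, eval_mul, eval_C, eval_pow, eval_sub, eval_add, eval_one, eval_X, hs, hc]
  generalize ((Real.sin (θ / 2) : ℝ) : ℂ) = s
  generalize ((Real.cos (θ / 2) : ℝ) : ℂ) = c
  generalize northOrder m = p
  generalize southOrder m = q
  rw [pow_add, mul_pow, mul_pow, one_div, inv_pow, inv_pow]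
  field_simp
  ring

theorem inner_modeL2 (m n : ℤ) (P Q : ℂ[X]) : inner ℂ (modeL2 m P) (modeL2 n Q) =
    ∫ x, modeFun n Q x.1 x.2 * (starRingEnd ℂ) (modeFun m P x.1 x.2) ∂sphereMeasure := by
  rw [L2.inner_def]
  refine integral_congr_ae ?_
  filter_upwards [coeFn_modeL2 m P, coeFn_modeL2 n Q] with x h1 h2
  rw [h1, h2, RCLike.inner_apply]

theorem exp_mul_conj_exp (m n : ℤ) (φ : ℝ) : Complex.exp (Complex.I * n * φ) *
    (starRingEnd ℂ) (Complex.exp (Complex.I * m * φ)) =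
      Complex.exp (Complex.I * ((n - m : ℤ) : ℂ) * φ) := by
  rw [← Complex.exp_conj, ← Complex.exp_add]
  congr 1
  simp only [map_mul, Complex.conj_I, Complex.conj_ofReal, map_intCast]
  push_cast
  ring

theorem integral_exp_mode {k : ℤ} (hk : k ≠ 0) :
    ∫ φ in (0 : ℝ)..2 * π, Complex.exp (Complex.I * k * φ) = 0 := by
  have hc : Complex.I * (k : ℂ) ≠ 0 := mul_ne_zero Complex.I_ne_zero (by exact_mod_cast hk)
  rw [integral_exp_mul_complex hc]
  have : Complex.I * k * ((2 * π : ℝ) : ℂ) = k * (2 * π * Complex.I) := by push_cast; ring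
  rw [this, Complex.exp_int_mul_two_pi_mul_I]
  simp

theorem inner_modeL2_of_ne {m n : ℤ} (h : m ≠ n) (P Q : ℂ[X]) :
    inner ℂ (modeL2 m P) (modeL2 n Q) = 0 := by
  rw [inner_modeL2,
    integral_sphere_eq_mul (fun θ : ℝ => modeFun n Q θ 0 * (starRingEnd ℂ) (modeFun m P θ 0))
      (fun φ : ℝ => Complex.exp (Complex.I * ((n - m : ℤ) : ℂ) * φ)),
    integral_exp_mode (sub_ne_zero.mpr h.symm), mul_zero]
  · intro x
    rw [← exp_mul_conj_exp]
    simp only [modeFun, map_mul, Complex.ofReal_zero, mul_zero, Complex.exp_zero, map_one]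
    ring

theorem inner_modeL2_self (m : ℤ) (P Q : ℂ[X]) : inner ℂ (modeL2 m P) (modeL2 m Q) =
    2 * π * ∫ θ in (0 : ℝ)..π,
      (weight m * P.map (starRingEnd ℂ) * Q).eval ((Real.cos θ : ℝ) : ℂ) * (Real.sin θ : ℝ) := by
  rw [inner_modeL2, integral_sphere_eq_mul
    (fun θ : ℝ => (weight m * P.map (starRingEnd ℂ) * Q).eval ((Real.cos θ : ℝ) : ℂ))
    (fun _ : ℝ => (1 : ℂ))]
  · simp
    ring
  · intro x
    have := exp_mul_conj_exp m m x.2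
    simp only [sub_self, Int.cast_zero, mul_zero, zero_mul, Complex.exp_zero] at this
    simp only [modeFun, map_mul, map_pow, Complex.conj_ofReal, eval_mul, eval_map_conj,
      weight_eval_cos]
    linear_combination ((((Real.sin (x.1 / 2) : ℝ) : ℂ) ^ northOrder m *
      ((Real.cos (x.1 / 2) : ℝ) : ℂ) ^ southOrder m) ^ 2 * Q.eval ((Real.cos x.1 : ℝ) : ℂ) *
      (starRingEnd ℂ) (P.eval ((Real.cos x.1 : ℝ) : ℂ))) * this

end Modes

/-! ### Coercivity of the horizon operator on each mode. -/

section Coercivity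

/-- The dimensionless ratio `a² / (M r₊)`. -/
def spinRatio (M a : ℝ) : ℝ := a ^ 2 / (M * rPlus M a)

theorem le_rPlus (M a : ℝ) : M ≤ rPlus M a := by
  unfold rPlus
  linarith [Real.sqrt_nonneg (M ^ 2 - a ^ 2)]

theorem spinRatio_nonneg {M : ℝ} (a : ℝ) (hM : 0 < M) : 0 ≤ spinRatio M a := by
  have := hM.trans_le (le_rPlus M a)
  unfold spinRatio
  positivity

theorem spinRatio_le {M : ℝ} (a : ℝ) (hM : 0 < M) : spinRatio M a ≤ a ^ 2 / M ^ 2 := by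
  unfold spinRatio
  have := le_rPlus M a
  rw [sq M]
  gcongr

/-- The real part of the zeroth order terms in the mode `m` of the horizon operator, beyond those of
the spin `-1` Laplacian. -/
def realPotential (M a : ℝ) (m : ℤ) (x : ℝ) : ℝ :=
  -(spinRatio M a * m ^ 2 * (1 - spinRatio M a / 4 * (1 - x ^ 2))) - spinRatio M a * m * x

/-- The zeroth order terms in the mode `m` of the horizon operator, beyond those of the spin `-1`
Laplacian. -/
def potentialPoly (M a : ℝ) (m : ℤ) : ℂ[X] :=
  -(C ((spinRatio M a * m ^ 2 : ℝ) : ℂ) * (1 - C ((spinRatio M a / 4 : ℝ) : ℂ) * (1 - X ^ 2))) -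
    C ((spinRatio M a * m : ℝ) : ℂ) * X + C (Complex.I * (a * m / M : ℝ))

theorem eval_potentialPoly (M a : ℝ) (m : ℤ) (x : ℝ) : (potentialPoly M a m).eval (x : ℂ) =
    (realPotential M a m x : ℂ) + Complex.I * (a * m / M : ℝ) := by
  simp only [potentialPoly, realPotential, eval_add, eval_sub, eval_neg, eval_mul, eval_C, eval_one,
    eval_pow, eval_X]
  push_cast
  ring

/-- The horizon operator acting on the polynomial part of the mode `m`. -/
def horizonPoly (M a : ℝ) (m : ℤ) : ℂ[X] →ₗ[ℂ] ℂ[X] :=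
  laplacianPoly m + LinearMap.mulLeft ℂ (potentialPoly M a m)

theorem horizonPoly_apply (M a : ℝ) (m : ℤ) (P : ℂ[X]) :
    horizonPoly M a m P = laplacianPoly m P + potentialPoly M a m * P := rfl

/-- The density of the `L²` norm of the mode `m` with polynomial part `P`. -/
def modeDensity (m : ℤ) (P : ℂ[X]) (θ : ℝ) : ℝ :=
  (Real.sin (θ / 2) ^ northOrder m * Real.cos (θ / 2) ^ southOrder m) ^ 2 *
    ‖P.eval ((Real.cos θ : ℝ) : ℂ)‖ ^ 2 * Real.sin θ

theorem continuous_modeDensity (m : ℤ) (P : ℂ[X]) : Continuous (modeDensity m P) := by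
  have := (continuous_eval_cos P).norm
  unfold modeDensity
  refine Continuous.mul (Continuous.mul ?_ (this.pow 2)) Real.continuous_sin
  fun_prop

theorem modeDensity_nonneg (m : ℤ) (P : ℂ[X]) {θ : ℝ} (hθ : θ ∈ Icc 0 π) :
    0 ≤ modeDensity m P θ :=
  mul_nonneg (by positivity) (Real.sin_nonneg_of_mem_Icc hθ)

theorem eval_weight_mul_conj_mul (m : ℤ) (P : ℂ[X]) (θ : ℝ) :
    (weight m * P.map (starRingEnd ℂ) * P).eval ((Real.cos θ : ℝ) : ℂ) * (Real.sin θ : ℝ) =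
      (modeDensity m P θ : ℂ) := by
  rw [eval_mul, eval_mul, eval_map_conj, mul_assoc _ ((starRingEnd ℂ) _), Complex.conj_mul',
    weight_eval_cos, modeDensity]
  push_cast
  ring

theorem norm_modeL2_sq (m : ℤ) (P : ℂ[X]) :
    ‖modeL2 m P‖ ^ 2 = 2 * π * ∫ θ in (0 : ℝ)..π, modeDensity m P θ := by
  have h := inner_self_eq_norm_sq_to_K (𝕜 := ℂ) (modeL2 m P)
  rw [inner_modeL2_self] at h
  simp_rw [eval_weight_mul_conj_mul] at h
  rw [intervalIntegral.integral_ofReal] at h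
  simp only [Complex.coe_algebraMap] at h
  exact_mod_cast h.symm

theorem continuous_realPotential (M a : ℝ) (m : ℤ) : Continuous (realPotential M a m) := by
  unfold realPotential
  fun_prop

/-- The Dirichlet form of the mode, split into real and imaginary parts. The imaginary part is a
constant multiple of the norm because `(a/(M r₊)) r₊ Z` acts as `i a m / M`, while the `i a cos θ`
term multiplied by `Z = i m` is real. -/
theorem inner_modeL2_horizonPoly (M a : ℝ) (m : ℤ) (P : ℂ[X]) :
    inner ℂ (modeL2 m P) (modeL2 m (horizonPoly M a m P)) =
      ((2 * π * ∫ θ in (0 : ℝ)..π, (((lowestSpin m : ℝ) * (lowestSpin m + 1) +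
          realPotential M a m (Real.cos θ)) * modeDensity m P θ +
          (1 - Real.cos θ ^ 2) * modeDensity m (derivative P) θ) : ℝ) : ℂ) +
        Complex.I * ((a * m / M * ‖modeL2 m P‖ ^ 2 : ℝ) : ℂ) := by
  have hpt : ∀ θ : ℝ, (weight m * P.map (starRingEnd ℂ) * horizonPoly M a m P).eval
      ((Real.cos θ : ℝ) : ℂ) * (Real.sin θ : ℝ) =
      (((((lowestSpin m : ℝ) * (lowestSpin m + 1) +
          realPotential M a m (Real.cos θ)) * modeDensity m P θ +
          (1 - Real.cos θ ^ 2) * modeDensity m (derivative P) θ : ℝ) : ℂ) +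
        Complex.I * ((a * m / M : ℝ) : ℂ) * ((modeDensity m P θ : ℝ) : ℂ)) -
      (derivative (weight m * (1 - X ^ 2) * derivative P * P.map (starRingEnd ℂ))).eval
        ((Real.cos θ : ℝ) : ℂ) * (Real.sin θ : ℝ) := fun θ => by
    have h1 := eval_weight_mul_conj_mul m P θ
    have h2 := eval_weight_mul_conj_mul m (derivative P) θ
    have h3 := eval_potentialPoly M a m (Real.cos θ)
    rw [← derivative_map] at h2
    rw [horizonPoly_apply, mul_add, weight_mul_laplacianPoly]
    simp only [Complex.ofReal_add, Complex.ofReal_mul _ (modeDensity _ _ _), ← h1, ← h2]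
    simp only [eval_add, eval_sub, eval_mul, eval_C, eval_one, eval_pow, eval_X, h3]
    push_cast
    ring
  have hc := continuous_modeDensity m P
  have hc' := continuous_modeDensity m (derivative P)
  have hb := (continuous_realPotential M a m).comp Real.continuous_cos
  rw [inner_modeL2_self]
  simp_rw [hpt]
  rw [intervalIntegral.integral_sub, intervalIntegral.integral_add, integral_derivative_eval_cos,
    intervalIntegral.integral_ofReal, intervalIntegral.integral_const_mul,
    intervalIntegral.integral_ofReal, norm_modeL2_sq]
  · simp only [eval_mul, eval_sub, eval_one, eval_pow, eval_X]
    push_cast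
    ring
  · refine (Complex.continuous_ofReal.comp ?_).intervalIntegrable _ _
    exact (Continuous.mul (continuous_const.add hb) hc).add (Continuous.mul (by fun_prop) hc')
  · exact (continuous_const.mul (Complex.continuous_ofReal.comp hc)).intervalIntegrable _ _
  · refine ((Complex.continuous_ofReal.comp ?_).add
      (continuous_const.mul (Complex.continuous_ofReal.comp hc))).intervalIntegrable _ _
    exact (Continuous.mul (continuous_const.add hb) hc).add (Continuous.mul (by fun_prop) hc')
  · exact ((continuous_eval_cos _).mul
      (Complex.continuous_ofReal.comp Real.continuous_sin)).intervalIntegrable _ _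

/-- Away from the modes in which the imaginary part is bounded below, the zeroth order terms
are. -/
theorem half_le_potential {M a : ℝ} (hM : 0 < M) (m : ℤ) (h : m = 0 ∨ |a| ≤ M / 2)
    {x : ℝ} (hx : x ∈ Icc (-1) 1) :
    1 / 2 ≤ (lowestSpin m : ℝ) * (lowestSpin m + 1) + realPotential M a m x := by
  have hl1 : (1 : ℝ) ≤ lowestSpin m := by
    exact_mod_cast (le_max_right _ _ : 1 ≤ lowestSpin m)
  have hlm : |(m : ℝ)| ≤ lowestSpin m := by
    have : m.natAbs ≤ lowestSpin m := le_max_left _ _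
    rw [← Int.cast_abs, Int.abs_eq_natAbs]
    exact_mod_cast this
  rcases h with rfl | h
  · simp only [realPotential, Int.cast_zero]
    nlinarith
  · have h0 := spinRatio_nonneg a hM
    have h4 : spinRatio M a ≤ 1 / 4 := by
      refine (spinRatio_le a hM).trans ?_
      rw [div_le_iff₀ (by positivity), ← sq_abs a]
      nlinarith [abs_nonneg a]
    unfold realPotential
    set α := spinRatio M a
    set l : ℝ := (lowestSpin m : ℝ)
    have e1 : (m : ℝ) ^ 2 ≤ l ^ 2 := by rw [← sq_abs]; gcongr
    have e2 : (m : ℝ) * x ≤ l := by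
      refine (le_abs_self _).trans ?_
      rw [abs_mul]
      nlinarith [abs_le.mpr hx, abs_nonneg (m : ℝ)]
    have e3 : 0 ≤ α / 4 * (1 - x ^ 2) := mul_nonneg (by positivity) (by nlinarith [hx.1, hx.2])
    have e4 : α * m ^ 2 * (1 - α / 4 * (1 - x ^ 2)) ≤ α * l ^ 2 := by
      calc α * m ^ 2 * (1 - α / 4 * (1 - x ^ 2)) ≤ α * m ^ 2 * 1 := by gcongr; linarith
        _ ≤ α * l ^ 2 := by rw [mul_one]; gcongr
    have e5 : α * m * x ≤ α * l := by rw [mul_assoc]; gcongr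
    -- The bounds leave `l(l+1) - α l² - α l = (1 - α) l(l+1)`, which is at least `3/2` since `α ≤
    -- 1/4` and `l ≥ 1`.
    nlinarith

/-- The modulus of the form dominates both its real and its imaginary part. The threshold `|a| =
M/2` is chosen so that one of them is always large: below it the potential is positive, above it `|a
m / M| ≥ 1/2` for `m ≠ 0`. -/
theorem horizonPoly_form_bound {M a : ℝ} (hM : 0 < M) (m : ℤ) (P : ℂ[X]) :
    1 / 2 * ‖modeL2 m P‖ ^ 2 ≤ ‖inner ℂ (modeL2 m P) (modeL2 m (horizonPoly M a m P))‖ := by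
  rw [inner_modeL2_horizonPoly]
  by_cases h : m = 0 ∨ |a| ≤ M / 2
  · refine le_trans ?_ ((le_abs_self _).trans (Complex.abs_re_le_norm _))
    simp only [Complex.add_re, Complex.ofReal_re, Complex.mul_re, Complex.I_re, zero_mul,
      Complex.I_im, Complex.ofReal_im, mul_zero, sub_zero, add_zero]
    rw [norm_modeL2_sq, mul_left_comm, ← intervalIntegral.integral_const_mul]
    refine mul_le_mul_of_nonneg_left ?_ (by positivity)
    have hc := continuous_modeDensity m P
    have hc' := continuous_modeDensity m (derivative P)
    have hb := (continuous_realPotential M a m).comp Real.continuous_cos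
    refine intervalIntegral.integral_mono_on Real.pi_pos.le
      ((continuous_const.mul hc).intervalIntegrable _ _)
      (((Continuous.mul (continuous_const.add hb) hc).add
        (Continuous.mul (by fun_prop) hc')).intervalIntegrable _ _) fun θ hθ => ?_
    have h1 := half_le_potential hM m h ⟨Real.neg_one_le_cos θ, Real.cos_le_one θ⟩
    have h2 := mul_le_mul_of_nonneg_right h1 (modeDensity_nonneg m P hθ)
    have h3 : 0 ≤ (1 - Real.cos θ ^ 2) * modeDensity m (derivative P) θ :=
      mul_nonneg (by nlinarith [Real.neg_one_le_cos θ, Real.cos_le_one θ])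
        (modeDensity_nonneg m _ hθ)
    linarith
  · push Not at h
    refine le_trans ?_ (Complex.abs_im_le_norm _)
    simp only [Complex.add_im, Complex.ofReal_im, Complex.mul_im, Complex.I_re, zero_mul,
      Complex.I_im, Complex.ofReal_re, one_mul, zero_add]
    rw [abs_mul, abs_of_nonneg (sq_nonneg ‖modeL2 m P‖)]
    gcongr
    have hm : (1 : ℝ) ≤ |(m : ℝ)| := by exact_mod_cast Int.one_le_abs h.1
    rw [abs_div, abs_mul, abs_of_pos hM, le_div_iff₀ hM]
    nlinarith [h.2]

/-- A polynomial in `cos θ` is bounded on the sphere. With `Q` the potential, this is the bounded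
perturbation `B` in Galerkin's argument. -/
theorem exists_norm_modeL2_mul_le (m : ℤ) (Q : ℂ[X]) :
    ∃ K, ∀ P, ‖modeL2 m (Q * P)‖ ≤ K * ‖modeL2 m P‖ := by
  obtain ⟨K, hK0, hK⟩ := exists_bound_eval_cos Q
  refine ⟨K, fun P => ?_⟩
  refine Lp.norm_le_mul_norm_of_ae_le_mul ?_
  filter_upwards [coeFn_modeL2 m (Q * P), coeFn_modeL2 m P] with x h1 h2
  rw [h1, h2]
  have : modeFun m (Q * P) x.1 x.2 = Q.eval ((Real.cos x.1 : ℝ) : ℂ) * modeFun m P x.1 x.2 := by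
    simp only [modeFun, eval_mul]
    ring
  rw [this, norm_mul]
  gcongr
  exact hK _

/-- A vector orthogonal to the range of the horizon operator on the mode `m` is orthogonal to that
mode. -/
theorem inner_modeL2_eq_zero {M a : ℝ} (hM : 0 < M) (m : ℤ) (v : SphereL2)
    (hv : ∀ P, inner ℂ v (modeL2 m (horizonPoly M a m P)) = 0) (P : ℂ[X]) :
    inner ℂ v (modeL2 m P) = 0 := by
  obtain ⟨K, hK⟩ := exists_norm_modeL2_mul_le m (potentialPoly M a m)
  refine inner_eq_zero_of_galerkin (modeL2 m) (laplacianPoly m)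
    (LinearMap.mulLeft ℂ (potentialPoly M a m)) (degreeLT ℂ) (fun _ _ h => degreeLT_mono h)
    (fun n => (degreeLTEquiv ℂ n).symm.finiteDimensional)
    (fun Q => ⟨Q.natDegree + 1, ?_⟩) (fun n Q => laplacianPoly_mem_degreeLT m n Q) K (1 / 2)
    (by norm_num) hK (horizonPoly_form_bound hM m) v hv P
  rw [degreeLT_succ_eq_degreeLE, mem_degreeLE]
  exact degree_le_natDegree

end Coercivity

/-! ### Totality of the modes, by Stone-Weierstrass on the sphere. -/

section Totality

theorem ae_sphere_mem : ∀ᵐ x ∂sphereMeasure, x ∈ Ioo 0 π ×ˢ Ioo 0 (2 * π) := by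
  have h1 : ∀ᵐ θ ∂((volume.restrict (Ioo 0 π)).withDensity
      fun θ => ENNReal.ofReal (Real.sin θ)), θ ∈ Ioo 0 π :=
    (withDensity_absolutelyContinuous _ _).ae_le (ae_restrict_mem measurableSet_Ioo)
  have h2 : ∀ᵐ φ ∂(volume.restrict (Ioc 0 (2 * π))), φ ∈ Ioo 0 (2 * π) := by
    rw [← Measure.restrict_congr_set Ioo_ae_eq_Ioc]
    exact ae_restrict_mem measurableSet_Ioo
  unfold sphereMeasure
  filter_upwards [Measure.quasiMeasurePreserving_fst.ae h1,
    Measure.quasiMeasurePreserving_snd.ae h2] with x hx1 hx2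
  exact ⟨hx1, hx2⟩

/-- The closed coordinate rectangle of the sphere. -/
abbrev CoordRect : Type := Icc (0 : ℝ) π × Icc (0 : ℝ) (2 * π)

/-- The coordinates `(z, x + i y)` of the point of the unit sphere with angles `(θ, φ)`. -/
def spherePoint (x : CoordRect) : ℝ × ℂ :=
  (Real.cos x.1, (Real.sin x.1 : ℝ) * Complex.exp (Complex.I * (x.2 : ℝ)))

theorem continuous_spherePoint : Continuous spherePoint := by
  unfold spherePoint
  refine Continuous.prodMk (by fun_prop) (Continuous.mul ?_ ?_)
  · exact Complex.continuous_ofReal.comp (by fun_prop)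
  · fun_prop

/-- The coordinates are injective except over the poles and the meridian `φ = 0`. Only one of the
two points has to be interior, which excludes an interior point being glued to a boundary point. -/
theorem spherePoint_eq {x y : CoordRect} (h : spherePoint x = spherePoint y)
    (hx : (x.1 : ℝ) ∈ Ioo 0 π ∧ (x.2 : ℝ) ∈ Ioo 0 (2 * π)) : x = y := by
  obtain ⟨⟨θ, hθ⟩, ⟨φ, hφ⟩⟩ := x
  obtain ⟨⟨θ', hθ'⟩, ⟨φ', hφ'⟩⟩ := y
  obtain ⟨h1, h2⟩ := Prod.ext_iff.mp h
  simp only [spherePoint] at h1 h2 hx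
  obtain rfl : θ = θ' := Real.injOn_cos hθ hθ' h1
  have hs : ((Real.sin θ : ℝ) : ℂ) ≠ 0 := by
    exact_mod_cast (Real.sin_pos_of_mem_Ioo hx.1).ne'
  obtain ⟨n, hn⟩ := Complex.exp_eq_exp_iff_exists_int.mp (mul_left_cancel₀ hs h2)
  have hn' : φ = φ' + n * (2 * π) := by
    have : Complex.I * ((φ : ℂ) - (φ' + n * (2 * π))) = 0 := by linear_combination hn
    have := (mul_eq_zero.mp this).resolve_left Complex.I_ne_zero
    exact_mod_cast sub_eq_zero.mp this
  have hpi := Real.pi_pos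
  have hn0 : n = 0 := by
    have l1 : n < 1 := by
      by_contra! hc
      have : (1 : ℝ) ≤ n := by exact_mod_cast hc
      nlinarith [hx.2.2, hφ'.1]
    have l2 : -1 < n := by
      by_contra! hc
      have : (n : ℝ) ≤ -1 := by exact_mod_cast hc
      nlinarith [hx.2.1, hφ'.2]
    omega
  obtain rfl : φ = φ' := by simpa [hn0] using hn'
  rfl

/-- The unit sphere, as the image of the coordinate rectangle. -/
abbrev SphereSet : Type := range spherePoint

/-- The projection of the coordinate rectangle onto the sphere. -/
def toSphere : C(CoordRect, SphereSet) :=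
  ⟨rangeFactorization spherePoint, continuous_spherePoint.subtype_mk _⟩

instance : CompactSpace SphereSet :=
  isCompact_iff_compactSpace.mp (isCompact_range continuous_spherePoint)

theorem isQuotientMap_toSphere : Topology.IsQuotientMap toSphere :=
  toSphere.continuous.isClosedMap.isQuotientMap toSphere.continuous rangeFactorization_surjective

/-- The monomials in the functions `z`, `x + i y`, `x - i y` on the sphere. -/
def sphereMonomial (k : ℕ × ℕ × ℕ) : C(SphereSet, ℂ) where
  toFun y := ((y : ℝ × ℂ).1 : ℂ) ^ k.1 * (y : ℝ × ℂ).2 ^ k.2.1 *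
    (starRingEnd ℂ) (y : ℝ × ℂ).2 ^ k.2.2
  continuous_toFun := by
    have := Complex.continuous_conj
    fun_prop

theorem sphereMonomial_mul (k l : ℕ × ℕ × ℕ) :
    sphereMonomial k * sphereMonomial l = sphereMonomial (k + l) := by
  ext y
  simp only [sphereMonomial, ContinuousMap.mul_apply, ContinuousMap.coe_mk, Prod.fst_add,
    Prod.snd_add, pow_add]
  ring

theorem star_sphereMonomial (k : ℕ × ℕ × ℕ) :
    star (sphereMonomial k) = sphereMonomial (k.1, k.2.2, k.2.1) := by
  ext y
  simp only [sphereMonomial, ContinuousMap.star_apply, ContinuousMap.coe_mk, RCLike.star_def,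
    map_mul, map_pow, Complex.conj_ofReal, Complex.conj_conj]
  ring

theorem sphereMonomial_zero : sphereMonomial 0 = 1 := by
  ext y
  simp [sphereMonomial]

/-- The algebra of polynomial functions on the sphere. -/
def spherePolynomials : StarSubalgebra ℂ C(SphereSet, ℂ) where
  carrier := Submodule.span ℂ (range sphereMonomial)
  add_mem' := add_mem
  zero_mem' := zero_mem _
  mul_mem' {A B} hA hB := by
    refine Submodule.span_induction₂ (p := fun A B _ _ =>
      A * B ∈ Submodule.span ℂ (range sphereMonomial)) ?_ ?_ ?_ ?_ ?_ ?_ ?_ hA hB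
    · rintro _ _ ⟨k, rfl⟩ ⟨l, rfl⟩
      rw [sphereMonomial_mul]
      exact Submodule.subset_span ⟨_, rfl⟩
    · intro B _; rw [zero_mul]; exact zero_mem _
    · intro A _; rw [mul_zero]; exact zero_mem _
    · intro A A' B _ _ _ h h'; rw [add_mul]; exact add_mem h h'
    · intro A B B' _ _ _ h h'; rw [mul_add]; exact add_mem h h'
    · intro r A B _ _ h; rw [smul_mul_assoc]; exact Submodule.smul_mem _ _ h
    · intro r A B _ _ h; rw [mul_smul_comm]; exact Submodule.smul_mem _ _ h
  one_mem' := Submodule.subset_span ⟨0, sphereMonomial_zero⟩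
  algebraMap_mem' r := by
    rw [Algebra.algebraMap_eq_smul_one]
    exact Submodule.smul_mem _ _ (Submodule.subset_span ⟨0, sphereMonomial_zero⟩)
  star_mem' {A} hA := by
    refine Submodule.span_induction (p := fun A _ =>
      star A ∈ Submodule.span ℂ (range sphereMonomial)) ?_ ?_ ?_ ?_ hA
    · rintro _ ⟨k, rfl⟩
      rw [star_sphereMonomial]
      exact Submodule.subset_span ⟨_, rfl⟩
    · rw [star_zero]; exact zero_mem _
    · intro A B _ _ h h'; rw [star_add]; exact add_mem h h'
    · intro r A _ h; rw [star_smul]; exact Submodule.smul_mem _ _ h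

theorem spherePolynomials_separatesPoints : spherePolynomials.SeparatesPoints := by
  intro y y' hne
  have hmem : ∀ k, sphereMonomial k ∈ spherePolynomials :=
    fun k => Submodule.subset_span ⟨k, rfl⟩
  by_cases h : (y : ℝ × ℂ).1 = (y' : ℝ × ℂ).1
  · refine ⟨_, ⟨_, hmem (0, 1, 0), rfl⟩, fun h' => hne (Subtype.ext (Prod.ext h ?_))⟩
    simpa [sphereMonomial] using h'
  · refine ⟨_, ⟨_, hmem (1, 0, 0), rfl⟩, fun h' => h ?_⟩
    simpa [sphereMonomial] using h'

/-- The product of the section `e^{iφ} cos²(θ/2)` with a monomial on the sphere is a mode. -/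
theorem exists_modeFun_eq (k : ℕ × ℕ × ℕ) : ∃ (m : ℤ) (P : ℂ[X]), ∀ θ φ : ℝ,
    modeFun m P θ φ = Complex.exp (Complex.I * φ) * ((Real.cos (θ / 2) : ℝ) : ℂ) ^ 2 *
      (((Real.cos θ : ℝ) : ℂ) ^ k.1 *
        ((Real.sin θ : ℝ) * Complex.exp (Complex.I * φ)) ^ k.2.1 *
        (starRingEnd ℂ) ((Real.sin θ : ℝ) * Complex.exp (Complex.I * φ)) ^ k.2.2) := by
  obtain ⟨a, b, c⟩ := k
  -- The mode number is `1 + b - c`, with orders `|b - c|` and `|b - c + 2|`. The half-angle powers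
  -- present exceed these by even numbers, and the surplus squares are the polynomials `(1 ∓ cos
  -- θ)/2`.
  obtain ⟨i, hi⟩ : ∃ i, b + c = northOrder (1 + b - c) + 2 * i :=
    ⟨min b c, by unfold northOrder; omega⟩
  obtain ⟨j, hj⟩ : ∃ j, b + c + 2 = southOrder (1 + b - c) + 2 * j :=
    ⟨min (b + 2) c, by unfold southOrder; omega⟩
  refine ⟨1 + b - c, C (2 ^ (b + c)) * X ^ a * (C (1 / 2) * (1 - X)) ^ i *
    (C (1 / 2) * (1 + X)) ^ j, fun θ φ => ?_⟩
  have h : Real.cos θ = Real.cos (θ / 2) ^ 2 - Real.sin (θ / 2) ^ 2 := by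
    rw [← Real.cos_two_mul', mul_div_cancel₀ _ two_ne_zero]
  have h1 : (1 : ℝ) = Real.cos (θ / 2) ^ 2 + Real.sin (θ / 2) ^ 2 :=
    (Real.cos_sq_add_sin_sq _).symm
  have hs : 1 / 2 * ((1 : ℂ) - (Real.cos θ : ℝ)) = ((Real.sin (θ / 2) : ℝ) : ℂ) ^ 2 := by
    have : 1 / 2 * ((1 : ℝ) - Real.cos θ) = Real.sin (θ / 2) ^ 2 := by linarith
    have := congrArg Complex.ofReal this
    push_cast at this ⊢
    exact this
  have hc : 1 / 2 * ((1 : ℂ) + (Real.cos θ : ℝ)) = ((Real.cos (θ / 2) : ℝ) : ℂ) ^ 2 := by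
    have : 1 / 2 * ((1 : ℝ) + Real.cos θ) = Real.cos (θ / 2) ^ 2 := by linarith
    have := congrArg Complex.ofReal this
    push_cast at this ⊢
    exact this
  have hsin : ((Real.sin θ : ℝ) : ℂ) =
      2 * ((Real.sin (θ / 2) : ℝ) : ℂ) * ((Real.cos (θ / 2) : ℝ) : ℂ) := by
    have : Real.sin θ = 2 * Real.sin (θ / 2) * Real.cos (θ / 2) := by
      rw [← Real.sin_two_mul, mul_div_cancel₀ _ two_ne_zero]
    exact_mod_cast congrArg Complex.ofReal this
  have hexp : Complex.exp (Complex.I * ((1 + b - c : ℤ) : ℂ) * φ) =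
      Complex.exp (Complex.I * φ) * Complex.exp (Complex.I * φ) ^ b *
        (starRingEnd ℂ) (Complex.exp (Complex.I * φ)) ^ c := by
    rw [← Complex.exp_conj, ← Complex.exp_nat_mul, ← Complex.exp_nat_mul, ← Complex.exp_add,
      ← Complex.exp_add, map_mul, Complex.conj_I, Complex.conj_ofReal]
    congr 1
    push_cast
    ring
  simp only [modeFun, eval_mul, eval_C, eval_pow, eval_X, eval_add, eval_sub, eval_one, hs, hc,
    map_mul, Complex.conj_ofReal, hexp]
  rw [hsin]
  generalize ((Real.sin (θ / 2) : ℝ) : ℂ) = s at *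
  generalize ((Real.cos (θ / 2) : ℝ) : ℂ) = t at *
  have e1 : s ^ northOrder (1 + b - c) * (s ^ 2) ^ i = s ^ b * s ^ c := by
    rw [← pow_mul, ← pow_add, ← pow_add, hi]
  have e2 : t ^ southOrder (1 + b - c) * (t ^ 2) ^ j = t ^ b * t ^ c * t ^ 2 := by
    rw [← pow_mul, ← pow_add, ← pow_add, ← pow_add, hj]
  simp only [mul_pow]
  set E := Complex.exp (Complex.I * φ)
  rw [pow_add (2 : ℂ) b c]
  calc _ = E * E ^ b * (starRingEnd ℂ) E ^ c * (2 ^ b * 2 ^ c) * ((Real.cos θ : ℝ) : ℂ) ^ a *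
        (s ^ northOrder (1 + b - c) * (s ^ 2) ^ i) *
        (t ^ southOrder (1 + b - c) * (t ^ 2) ^ j) := by ring
    _ = _ := by rw [e1, e2]; ring

/-- The point of the closed coordinate rectangle nearest to given angles. -/
def clampRect (x : ℝ × ℝ) : CoordRect :=
  (projIcc 0 π Real.pi_pos.le x.1, projIcc 0 (2 * π) Real.two_pi_pos.le x.2)

theorem continuous_clampRect : Continuous clampRect := by
  unfold clampRect
  exact (continuous_projIcc.comp continuous_fst).prodMk (continuous_projIcc.comp continuous_snd)

theorem clampRect_of_mem {x : ℝ × ℝ} (hx : x ∈ Ioo 0 π ×ˢ Ioo 0 (2 * π)) :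
    clampRect x = (⟨x.1, Ioo_subset_Icc_self hx.1⟩, ⟨x.2, Ioo_subset_Icc_self hx.2⟩) := by
  unfold clampRect
  rw [projIcc_of_mem _ (Ioo_subset_Icc_self hx.1), projIcc_of_mem _ (Ioo_subset_Icc_self hx.2)]

/-- A function vanishing off the open coordinate rectangle descends to the sphere. -/
theorem exists_continuousMap_sphere (g : ℝ × ℝ → ℂ) (hg : Continuous g)
    (h0 : ∀ x, x ∉ Ioo 0 π ×ˢ Ioo 0 (2 * π) → g x = 0) :
    ∃ G : C(SphereSet, ℂ), ∀ x : CoordRect, G (toSphere x) = g (x.1, x.2) := by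
  have hfac : Function.FactorsThrough (fun x : CoordRect => g (x.1, x.2)) toSphere := by
    intro x y hxy
    have hxy' : spherePoint x = spherePoint y := congrArg Subtype.val hxy
    by_cases hx : (x.1 : ℝ) ∈ Ioo 0 π ∧ (x.2 : ℝ) ∈ Ioo 0 (2 * π)
    · rw [spherePoint_eq hxy' hx]
    · by_cases hy : (y.1 : ℝ) ∈ Ioo 0 π ∧ (y.2 : ℝ) ∈ Ioo 0 (2 * π)
      · rw [spherePoint_eq hxy'.symm hy]
      · exact (h0 (x.1, x.2) hx).trans (h0 (y.1, y.2) hy).symm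
  refine ⟨isQuotientMap_toSphere.lift ⟨fun x : CoordRect => g (x.1, x.2), by fun_prop⟩ hfac,
    fun x => ?_⟩
  exact congrArg (fun F : C(CoordRect, ℂ) => F x)
    (isQuotientMap_toSphere.lift_comp ⟨fun x : CoordRect => g (x.1, x.2), by fun_prop⟩ hfac)

/-- The modes span a dense subspace of `L²(dΩ)`. -/
theorem eq_zero_of_inner_modeL2_eq_zero (v : SphereL2)
    (hv : ∀ m P, inner ℂ v (modeL2 m P) = 0) : v = 0 := by
  -- `σ` is a section of spin weight `-1` vanishing only at the south pole. Multiplication by it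
  -- turns scalar polynomials on the sphere into modes, which reduces totality to a statement about
  -- scalar functions.
  let σ : ℝ × ℝ → ℂ := fun x =>
    Complex.exp (Complex.I * x.2) * ((Real.cos (x.1 / 2) : ℝ) : ℂ) ^ 2
  let w : ℝ × ℝ → ℂ := fun x => (starRingEnd ℂ) (v x) * σ x
  have hσc : Continuous σ :=
    Continuous.mul (by fun_prop) ((Complex.continuous_ofReal.comp (by fun_prop)).pow 2)
  have hvint : Integrable (fun x => (starRingEnd ℂ) (v x)) sphereMeasure :=
    Complex.conjLIE.toContinuousLinearEquiv.toContinuousLinearMap.integrable_comp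
      ((Lp.memLp v).integrable one_le_two)
  have hσb : ∀ x, ‖σ x‖ ≤ 1 := fun x => by
    have h1 := norm_exp_mode 1 x.2
    rw [Int.cast_one, mul_one] at h1
    have h2 : ‖((Real.cos (x.1 / 2) : ℝ) : ℂ)‖ ≤ 1 := by
      rw [Complex.norm_real]; exact Real.abs_cos_le_one _
    rw [norm_mul, h1, one_mul, norm_pow]
    exact pow_le_one₀ (norm_nonneg _) h2
  have hw : Integrable w sphereMeasure :=
    hvint.mul_bdd (c := 1) hσc.aestronglyMeasurable (.of_forall hσb)
  have hprod : ∀ A : C(SphereSet, ℂ),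
      Integrable (fun x => w x * A (toSphere (clampRect x))) sphereMeasure := fun A =>
    hw.mul_bdd (c := ‖A‖)
      (A.continuous.comp (toSphere.continuous.comp continuous_clampRect)).aestronglyMeasurable
      (.of_forall fun x => A.norm_coe_le_norm _)
  have hmon : ∀ k, ∫ x, w x * sphereMonomial k (toSphere (clampRect x)) ∂sphereMeasure = 0 := by
    intro k
    obtain ⟨m, P, hP⟩ := exists_modeFun_eq k
    rw [← hv m P, L2.inner_def]
    refine integral_congr_ae ?_
    filter_upwards [coeFn_modeL2 m P, ae_sphere_mem] with x h1 hx
    rw [h1, RCLike.inner_apply, hP, clampRect_of_mem hx]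
    change (starRingEnd ℂ) (v x) * σ x * (((Real.cos x.1 : ℝ) : ℂ) ^ k.1 *
        ((Real.sin x.1 : ℝ) * Complex.exp (Complex.I * x.2)) ^ k.2.1 *
        (starRingEnd ℂ) ((Real.sin x.1 : ℝ) * Complex.exp (Complex.I * x.2)) ^ k.2.2) =
      σ x * _ * (starRingEnd ℂ) (v x)
    ring
  have hpoly : ∀ A ∈ spherePolynomials,
      ∫ x, w x * A (toSphere (clampRect x)) ∂sphereMeasure = 0 := by
    intro A hA
    refine Submodule.span_induction (p := fun A _ =>
      ∫ x, w x * A (toSphere (clampRect x)) ∂sphereMeasure = 0) ?_ ?_ ?_ ?_ hA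
    · rintro _ ⟨k, rfl⟩; exact hmon k
    · simp
    · intro A B _ _ h h'
      simp only [ContinuousMap.add_apply, mul_add]
      rw [integral_add (hprod A) (hprod B), h, h', add_zero]
    · intro r A _ h
      simp only [ContinuousMap.smul_apply, smul_eq_mul, mul_left_comm _ r]
      rw [integral_const_mul, h, mul_zero]
  have hall : ∀ G : C(SphereSet, ℂ),
      ∫ x, w x * G (toSphere (clampRect x)) ∂sphereMeasure = 0 := by
    intro G
    have hG : G ∈ spherePolynomials.topologicalClosure := by
      rw [ContinuousMap.starSubalgebra_topologicalClosure_eq_top_of_separatesPoints _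
        spherePolynomials_separatesPoints]
      trivial
    have hG' : G ∈ closure (spherePolynomials : Set C(SphereSet, ℂ)) := hG
    set K := ∫ x, ‖w x‖ ∂sphereMeasure with hK
    have hK0 : 0 ≤ K := integral_nonneg fun x => norm_nonneg _
    refine norm_le_zero_iff.mp (le_of_forall_pos_le_add fun ε hε => ?_)
    obtain ⟨A, hA, hAG⟩ := Metric.mem_closure_iff.mp hG' (ε / (K + 1)) (by positivity)
    have : ∫ x, w x * G (toSphere (clampRect x)) ∂sphereMeasure =
        ∫ x, w x * (G - A) (toSphere (clampRect x)) ∂sphereMeasure := by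
      simp only [ContinuousMap.sub_apply, mul_sub]
      rw [integral_sub (hprod G) (hprod A), hpoly A hA, sub_zero]
    rw [this, zero_add]
    calc _ ≤ ∫ x, ‖w x‖ * (ε / (K + 1)) ∂sphereMeasure := by
          refine norm_integral_le_of_norm_le (hw.norm.mul_const _) (.of_forall fun x => ?_)
          rw [norm_mul]
          gcongr
          rw [dist_eq_norm] at hAG
          exact ((G - A).norm_coe_le_norm _).trans hAG.le
      _ = K * (ε / (K + 1)) := by rw [integral_mul_const]
      _ ≤ ε := by
          rw [mul_div_assoc', div_le_iff₀ (by positivity)]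
          nlinarith
  -- Test functions compactly supported in the open rectangle descend to continuous functions on the
  -- sphere, so they are all annihilated by `w`.
  have hw0 : ∀ᵐ x ∂sphereMeasure, x ∈ Ioo 0 π ×ˢ Ioo 0 (2 * π) → w x = 0 := by
    refine (isOpen_Ioo.prod isOpen_Ioo).ae_eq_zero_of_integral_contDiff_smul_eq_zero
      (hw.locallyIntegrable.locallyIntegrableOn _) fun g hg _ hsupp => ?_
    obtain ⟨G, hG⟩ := exists_continuousMap_sphere (fun x => (g x : ℂ))
      (Complex.continuous_ofReal.comp hg.continuous) fun x hx => by
        have : x ∉ tsupport g := fun h => hx (hsupp h)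
        simp [image_eq_zero_of_notMem_tsupport this]
    rw [← hall G]
    refine integral_congr_ae ?_
    filter_upwards [ae_sphere_mem] with x hx
    rw [clampRect_of_mem hx, hG, Complex.real_smul, mul_comm]
  rw [Lp.eq_zero_iff_ae_eq_zero]
  filter_upwards [hw0, ae_sphere_mem] with x h1 hx
  have hcos : 0 < Real.cos (x.1 / 2) :=
    Real.cos_pos_of_mem_Ioo ⟨by linarith [hx.1.1, Real.pi_pos], by linarith [hx.1.2]⟩
  have hσ0 : σ x ≠ 0 :=
    mul_ne_zero (Complex.exp_ne_zero _) (pow_ne_zero _ (by exact_mod_cast hcos.ne'))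
  simpa using (mul_eq_zero.mp (h1 hx)).resolve_right hσ0

end Totality

/-! ### Regularity of smooth spin-weighted functions in the coordinates `(θ, φ)`. -/

section Calculus

/-- Joint smoothness on the strip `(α, β) × ℝ`. -/
def SmoothStrip (α β : ℝ) (f : ℝ → ℝ → ℂ) : Prop :=
  ContDiffOn ℝ ∞ (fun x : ℝ × ℝ => f x.1 x.2) (Ioo α β ×ˢ univ)

theorem isOpen_strip (α β : ℝ) : IsOpen (Ioo α β ×ˢ (univ : Set ℝ)) := isOpen_Ioo.prod isOpen_univ

namespace SmoothStrip

variable {α β : ℝ} {f g : ℝ → ℝ → ℂ}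

theorem hasFDerivAt (hf : SmoothStrip α β f) {θ : ℝ} (hθ : θ ∈ Ioo α β) (φ : ℝ) :
    HasFDerivAt (fun x : ℝ × ℝ => f x.1 x.2)
      (fderiv ℝ (fun x : ℝ × ℝ => f x.1 x.2) (θ, φ)) (θ, φ) :=
  ((hf.contDiffAt ((isOpen_strip α β).mem_nhds ⟨hθ, mem_univ _⟩)).differentiableAt
    (by simp)).hasFDerivAt

theorem hasDerivAt_dTheta_fderiv (hf : SmoothStrip α β f) {θ : ℝ} (hθ : θ ∈ Ioo α β) (φ : ℝ) :
    HasDerivAt (fun t => f t φ) (fderiv ℝ (fun x : ℝ × ℝ => f x.1 x.2) (θ, φ) (1, 0)) θ :=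
  HasFDerivAt.comp_hasDerivAt (f := fun t : ℝ => (t, φ)) θ (hf.hasFDerivAt hθ φ)
    ((hasDerivAt_id θ).prodMk (hasDerivAt_const θ φ))

theorem hasDerivAt_Z_fderiv (hf : SmoothStrip α β f) {θ : ℝ} (hθ : θ ∈ Ioo α β) (φ : ℝ) :
    HasDerivAt (fun t => f θ t) (fderiv ℝ (fun x : ℝ × ℝ => f x.1 x.2) (θ, φ) (0, 1)) φ :=
  HasFDerivAt.comp_hasDerivAt (f := fun t : ℝ => (θ, t)) φ (hf.hasFDerivAt hθ φ)
    ((hasDerivAt_const φ θ).prodMk (hasDerivAt_id φ))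

theorem dTheta_eq (hf : SmoothStrip α β f) {θ : ℝ} (hθ : θ ∈ Ioo α β) (φ : ℝ) :
    dTheta f θ φ = fderiv ℝ (fun x : ℝ × ℝ => f x.1 x.2) (θ, φ) (1, 0) :=
  (hf.hasDerivAt_dTheta_fderiv hθ φ).deriv

theorem Z_eq (hf : SmoothStrip α β f) {θ : ℝ} (hθ : θ ∈ Ioo α β) (φ : ℝ) :
    Z f θ φ = fderiv ℝ (fun x : ℝ × ℝ => f x.1 x.2) (θ, φ) (0, 1) :=
  (hf.hasDerivAt_Z_fderiv hθ φ).deriv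

theorem hasDerivAt_dTheta (hf : SmoothStrip α β f) {θ : ℝ} (hθ : θ ∈ Ioo α β) (φ : ℝ) :
    HasDerivAt (fun t => f t φ) (dTheta f θ φ) θ := by
  rw [hf.dTheta_eq hθ]; exact hf.hasDerivAt_dTheta_fderiv hθ φ

theorem hasDerivAt_Z (hf : SmoothStrip α β f) {θ : ℝ} (hθ : θ ∈ Ioo α β) (φ : ℝ) :
    HasDerivAt (fun t => f θ t) (Z f θ φ) φ := by
  rw [hf.Z_eq hθ]; exact hf.hasDerivAt_Z_fderiv hθ φ

theorem dTheta (hf : SmoothStrip α β f) : SmoothStrip α β (dTheta f) :=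
  ((hf.fderiv_of_isOpen (isOpen_strip α β) (m := ∞) (by simp)).clm_apply
    (contDiffOn_const (c := ((1 : ℝ), (0 : ℝ))))).congr fun x hx => hf.dTheta_eq hx.1 x.2

theorem Z (hf : SmoothStrip α β f) : SmoothStrip α β (Z f) :=
  ((hf.fderiv_of_isOpen (isOpen_strip α β) (m := ∞) (by simp)).clm_apply
    (contDiffOn_const (c := ((0 : ℝ), (1 : ℝ))))).congr fun x hx => hf.Z_eq hx.1 x.2

theorem mul (hf : SmoothStrip α β f) (hg : SmoothStrip α β g) :
    SmoothStrip α β fun θ φ => f θ φ * g θ φ :=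
  ContDiffOn.mul hf hg

theorem add (hf : SmoothStrip α β f) (hg : SmoothStrip α β g) :
    SmoothStrip α β fun θ φ => f θ φ + g θ φ :=
  ContDiffOn.add hf hg

theorem sub (hf : SmoothStrip α β f) (hg : SmoothStrip α β g) :
    SmoothStrip α β fun θ φ => f θ φ - g θ φ :=
  ContDiffOn.sub hf hg

theorem conj (hf : SmoothStrip α β f) : SmoothStrip α β fun θ φ => (starRingEnd ℂ) (f θ φ) :=
  Complex.conjCLE.contDiff.comp_contDiffOn hf

theorem of_polar {c : ℝ → ℂ} (hc : ContDiffOn ℝ ∞ c (Ioo α β)) : SmoothStrip α β fun θ _ => c θ :=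
  hc.comp contDiff_fst.contDiffOn fun _ hx => hx.1

theorem of_contDiff {F : ℝ × ℝ → ℂ} (hF : ContDiff ℝ ∞ F) : SmoothStrip α β fun θ φ => F (θ, φ) :=
  hF.contDiffOn

theorem exists_bound (hf : SmoothStrip α β f) {γ δ : ℝ} (h : Icc γ δ ⊆ Ioo α β) :
    ∃ C, ∀ θ ∈ Icc γ δ, ∀ φ ∈ Icc 0 (2 * π), ‖f θ φ‖ ≤ C := by
  obtain ⟨C, hC⟩ := (isCompact_Icc.prod
    (isCompact_Icc (a := 0) (b := 2 * π))).exists_bound_of_continuousOn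
    (hf.continuousOn.mono (prod_mono h (subset_univ _)))
  exact ⟨C, fun θ hθ φ hφ => hC (θ, φ) ⟨hθ, hφ⟩⟩

end SmoothStrip

theorem dTheta_congr {α β : ℝ} {f g : ℝ → ℝ → ℂ} (h : ∀ θ ∈ Ioo α β, ∀ φ, f θ φ = g θ φ) {θ : ℝ}
    (hθ : θ ∈ Ioo α β) (φ : ℝ) : dTheta f θ φ = dTheta g θ φ :=
  Filter.EventuallyEq.deriv_eq
    (Filter.mem_of_superset (isOpen_Ioo.mem_nhds hθ) fun _ ht => h _ ht φ)

theorem contDiff_ofReal : ContDiff ℝ ∞ (fun x : ℝ => (x : ℂ)) := Complex.ofRealCLM.contDiff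

theorem contDiff_exp_I_mul (k : ℂ) : ContDiff ℝ ∞ (fun x : ℝ => Complex.exp (k * x)) :=
  (contDiff_const.mul contDiff_ofReal).cexp

/-- The properties of smooth spin-weighted functions that Green's identity uses. -/
structure IsTame (f : ℝ → ℝ → ℂ) : Prop where
  smooth : SmoothStrip 0 π f
  bounded : ∃ C, ∀ θ ∈ Ioo 0 π, ∀ φ ∈ Icc 0 (2 * π), ‖f θ φ‖ ≤ C ∧ ‖dTheta f θ φ‖ ≤ C
  periodic : ∀ θ ∈ Ioo 0 π, ∀ φ, f θ (φ + 2 * π) = f θ φ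

theorem IsTame.Z_periodic {f : ℝ → ℝ → ℂ} (hf : IsTame f) {θ : ℝ} (hθ : θ ∈ Ioo 0 π) (φ : ℝ) :
    Z f θ (φ + 2 * π) = Z f θ φ := by
  unfold Z
  rw [← deriv_comp_add_const]
  congr 1
  exact funext fun t => hf.periodic θ hθ t

theorem dTheta_conj {α β : ℝ} {f : ℝ → ℝ → ℂ} (hf : SmoothStrip α β f) {θ : ℝ} (hθ : θ ∈ Ioo α β)
    (φ : ℝ) : dTheta (fun θ φ => (starRingEnd ℂ) (f θ φ)) θ φ = (starRingEnd ℂ) (dTheta f θ φ) :=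
  (hf.hasDerivAt_dTheta hθ φ).star.deriv

theorem Z_conj {α β : ℝ} {f : ℝ → ℝ → ℂ} (hf : SmoothStrip α β f) {θ : ℝ} (hθ : θ ∈ Ioo α β)
    (φ : ℝ) : Z (fun θ φ => (starRingEnd ℂ) (f θ φ)) θ φ = (starRingEnd ℂ) (Z f θ φ) :=
  (hf.hasDerivAt_Z hθ φ).star.deriv

theorem IsTame.conj {f : ℝ → ℝ → ℂ} (hf : IsTame f) :
    IsTame fun θ φ => (starRingEnd ℂ) (f θ φ) where
  smooth := hf.smooth.conj
  bounded := by
    obtain ⟨C, hC⟩ := hf.bounded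
    refine ⟨C, fun θ hθ φ hφ => ?_⟩
    rw [dTheta_conj hf.smooth hθ, RCLike.norm_conj, RCLike.norm_conj]
    exact hC θ hθ φ hφ
  periodic θ hθ φ := by rw [hf.periodic θ hθ]

theorem exp_I_mul_add_two_pi (k : ℤ) (φ : ℝ) :
    Complex.exp (Complex.I * k * ((φ + 2 * π : ℝ) : ℂ)) = Complex.exp (Complex.I * k * φ) := by
  have : Complex.I * k * ((φ + 2 * π : ℝ) : ℂ) =
      Complex.I * k * φ + k * (2 * π * Complex.I) := by push_cast; ring
  rw [this, Complex.exp_add, Complex.exp_int_mul_two_pi_mul_I, mul_one]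

namespace IsSmoothSpinWeighted

variable {s : ℤ} {f : ℝ → ℝ → ℂ}

/-- Polar coordinates `tan(θ/2) e^{iφ}` remain smooth for `θ ≤ 0`, even though they are not a chart
there. Continuing past the pole makes bounds near it a matter of compactness. -/
theorem exists_north_extension (hf : IsSmoothSpinWeighted s f) :
    ∃ N : ℝ → ℝ → ℂ, SmoothStrip (-π) π N ∧ ∀ θ ∈ Ioo 0 π, ∀ φ, f θ φ = N θ φ := by
  obtain ⟨gN, gS, hN, hS, h⟩ := hf
  refine ⟨fun θ φ => Complex.exp (-(Complex.I * s) * φ) *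
    gN ((Real.tan (θ / 2) : ℂ) * Complex.exp (Complex.I * φ)), ?_, fun θ hθ φ => ?_⟩
  · have h1 : SmoothStrip (-π) π fun θ _ => ((Real.tan (θ / 2) : ℝ) : ℂ) := by
      refine SmoothStrip.of_polar (contDiff_ofReal.comp_contDiffOn fun θ hθ => ?_)
      have hc : Real.cos (θ / 2) ≠ 0 :=
        (Real.cos_pos_of_mem_Ioo ⟨by linarith [hθ.1], by linarith [hθ.2]⟩).ne'
      exact ((Real.contDiffAt_tan.mpr hc).comp θ (contDiffAt_id.div_const 2)).contDiffWithinAt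
    have h2 : SmoothStrip (-π) π fun _ φ => Complex.exp (Complex.I * φ) :=
      .of_contDiff ((contDiff_exp_I_mul Complex.I).comp contDiff_snd)
    have h3 : SmoothStrip (-π) π fun _ φ => Complex.exp (-(Complex.I * s) * φ) :=
      .of_contDiff ((contDiff_exp_I_mul _).comp contDiff_snd)
    exact h3.mul (hN.comp_contDiffOn (h1.mul h2))
  · beta_reduce
    rw [← (h θ hθ φ).1, ← mul_assoc, ← Complex.exp_add]
    simp

theorem exists_south_extension (hf : IsSmoothSpinWeighted s f) :
    ∃ N : ℝ → ℝ → ℂ, SmoothStrip 0 (2 * π) N ∧ ∀ θ ∈ Ioo 0 π, ∀ φ, f θ φ = N θ φ := by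
  obtain ⟨gN, gS, hN, hS, h⟩ := hf
  -- The cotangent is written as `cos/sin`, which is visibly smooth at `θ = π`, where `tan (θ / 2)`
  -- has a pole.
  refine ⟨fun θ φ => Complex.exp (Complex.I * s * φ) *
    gS (((Real.cos (θ / 2) / Real.sin (θ / 2) : ℝ) : ℂ) * Complex.exp (Complex.I * φ)), ?_,
    fun θ hθ φ => ?_⟩
  · have h1 : SmoothStrip 0 (2 * π)
        fun θ _ => ((Real.cos (θ / 2) / Real.sin (θ / 2) : ℝ) : ℂ) := by
      refine SmoothStrip.of_polar (contDiff_ofReal.comp_contDiffOn ?_)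
      refine ContDiffOn.div (by fun_prop) (by fun_prop) fun θ hθ => ?_
      exact (Real.sin_pos_of_mem_Ioo ⟨by linarith [hθ.1], by linarith [hθ.2]⟩).ne'
    have h2 : SmoothStrip 0 (2 * π) fun _ φ => Complex.exp (Complex.I * φ) :=
      .of_contDiff ((contDiff_exp_I_mul Complex.I).comp contDiff_snd)
    have h3 : SmoothStrip 0 (2 * π) fun _ φ => Complex.exp (Complex.I * s * φ) :=
      .of_contDiff ((contDiff_exp_I_mul _).comp contDiff_snd)
    exact h3.mul (hS.comp_contDiffOn (h1.mul h2))
  · have : ((Real.cos (θ / 2) / Real.sin (θ / 2) : ℝ) : ℂ) = ((Real.tan (θ / 2))⁻¹ : ℂ) := by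
      rw [← Complex.ofReal_inv, Real.tan_eq_sin_div_cos, inv_div]
    beta_reduce
    rw [this, ← (h θ hθ φ).2, ← mul_assoc, ← Complex.exp_add]
    simp

/-- The bounds follow from compactness of each closed half of the rectangle, inside the strip of the
extension across the corresponding pole. -/
theorem isTame (hf : IsSmoothSpinWeighted s f) : IsTame f where
  smooth := by
    obtain ⟨N, hN, hfN⟩ := hf.exists_north_extension
    refine (ContDiffOn.mono hN (prod_mono (Ioo_subset_Ioo_left ?_) subset_rfl)).congr
      fun x hx => hfN x.1 hx.1 x.2
    linarith [Real.pi_pos]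
  bounded := by
    have hpi := Real.pi_pos
    obtain ⟨N, hN, hfN⟩ := hf.exists_north_extension
    obtain ⟨S, hS, hfS⟩ := hf.exists_south_extension
    have i1 : Icc 0 (π / 2) ⊆ Ioo (-π) π := Icc_subset_Ioo (by linarith) (by linarith)
    have i2 : Icc (π / 2) π ⊆ Ioo 0 (2 * π) := Icc_subset_Ioo (by linarith) (by linarith)
    obtain ⟨C1, h1⟩ := hN.exists_bound i1
    obtain ⟨C2, h2⟩ := hN.dTheta.exists_bound i1
    obtain ⟨C3, h3⟩ := hS.exists_bound i2
    obtain ⟨C4, h4⟩ := hS.dTheta.exists_bound i2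
    refine ⟨max (max C1 C2) (max C3 C4), fun θ hθ φ hφ => ?_⟩
    rcases le_total θ (π / 2) with hle | hle
    · have hθ' : θ ∈ Icc 0 (π / 2) := ⟨hθ.1.le, hle⟩
      rw [dTheta_congr hfN hθ, hfN θ hθ]
      exact ⟨(h1 θ hθ' φ hφ).trans (by simp), (h2 θ hθ' φ hφ).trans (by simp)⟩
    · have hθ' : θ ∈ Icc (π / 2) π := ⟨hle, hθ.2.le⟩
      rw [dTheta_congr hfS hθ, hfS θ hθ]
      exact ⟨(h3 θ hθ' φ hφ).trans (by simp), (h4 θ hθ' φ hφ).trans (by simp)⟩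
  periodic θ hθ φ := by
    obtain ⟨gN, gS, -, -, h⟩ := hf
    have e1 := (h θ hθ φ).1
    have e2 := (h θ hθ (φ + 2 * π)).1
    have e3 := exp_I_mul_add_two_pi 1 φ
    rw [Int.cast_one, mul_one] at e3
    rw [exp_I_mul_add_two_pi, e3, ← e1] at e2
    exact mul_left_cancel₀ (Complex.exp_ne_zero _) e2

end IsSmoothSpinWeighted

end Calculus

/-! ### Green's identity on the sphere for axisymmetric operators. -/

section Green

/-- The operator `-(1/sin θ) ∂_θ (sin θ ∂_θ) + c₂ Z² + c₁ Z + c₀` with coefficients depending on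
`θ`. -/
def axisymmetricExpr (c₂ c₁ c₀ : ℝ → ℂ) (f : ℝ → ℝ → ℂ) (θ φ : ℝ) : ℂ :=
  -(1 / (Real.sin θ : ℂ)) * dTheta (fun t p => (Real.sin t : ℂ) * dTheta f t p) θ φ +
    c₂ θ * Z (Z f) θ φ + c₁ θ * Z f θ φ + c₀ θ * f θ φ

/-- The polar component of the flux in Green's identity. -/
def polarFlux (f g : ℝ → ℝ → ℂ) (θ φ : ℝ) : ℂ :=
  f θ φ * ((Real.sin θ : ℂ) * dTheta g θ φ) - g θ φ * ((Real.sin θ : ℂ) * dTheta f θ φ)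

/-- The azimuthal component of the flux in Green's identity. -/
def azimuthalFlux (c₂ c₁ : ℝ → ℂ) (f g : ℝ → ℝ → ℂ) (θ φ : ℝ) : ℂ :=
  (Real.sin θ : ℂ) * c₂ θ * (g θ φ * Z f θ φ - f θ φ * Z g θ φ) +
    (Real.sin θ : ℂ) * c₁ θ * (g θ φ * f θ φ)

variable {f g : ℝ → ℝ → ℂ} {c₂ c₁ c₀ : ℝ → ℂ}

theorem contDiff_ofReal_sin : ContDiff ℝ ∞ fun θ : ℝ => (Real.sin θ : ℂ) :=
  contDiff_ofReal.comp Real.contDiff_sin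

theorem smoothStrip_sin {α β : ℝ} : SmoothStrip α β fun θ _ => (Real.sin θ : ℂ) :=
  .of_polar contDiff_ofReal_sin.contDiffOn

theorem smoothStrip_polarFlux {α β : ℝ} (hf : SmoothStrip α β f) (hg : SmoothStrip α β g) :
    SmoothStrip α β (polarFlux f g) :=
  (hf.mul (smoothStrip_sin.mul hg.dTheta)).sub (hg.mul (smoothStrip_sin.mul hf.dTheta))

theorem smoothStrip_azimuthalFlux {α β : ℝ} (hf : SmoothStrip α β f) (hg : SmoothStrip α β g)
    (h₂ : ContDiffOn ℝ ∞ c₂ (Ioo α β)) (h₁ : ContDiffOn ℝ ∞ c₁ (Ioo α β)) :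
    SmoothStrip α β (azimuthalFlux c₂ c₁ f g) :=
  ((smoothStrip_sin.mul (.of_polar h₂)).mul ((hg.mul hf.Z).sub (hf.mul hg.Z))).add
    ((smoothStrip_sin.mul (.of_polar h₁)).mul (hg.mul hf))

/-- Lagrange's identity. The sign of `c₁` flips in the transpose because `Z` is antisymmetric and
`c₁` does not depend on `φ`. -/
theorem divergence_flux (hf : SmoothStrip 0 π f) (hg : SmoothStrip 0 π g) {θ : ℝ}
    (hθ : θ ∈ Ioo 0 π) (φ : ℝ) :
    dTheta (polarFlux f g) θ φ + Z (azimuthalFlux c₂ c₁ f g) θ φ =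
      (Real.sin θ : ℂ) * (g θ φ * axisymmetricExpr c₂ c₁ c₀ f θ φ -
        f θ φ * axisymmetricExpr c₂ (-c₁) c₀ g θ φ) := by
  have hs : (Real.sin θ : ℂ) ≠ 0 := by exact_mod_cast (Real.sin_pos_of_mem_Ioo hθ).ne'
  have h1 : dTheta (polarFlux f g) θ φ = _ :=
    (((hf.hasDerivAt_dTheta hθ φ).mul
      ((smoothStrip_sin.mul hg.dTheta).hasDerivAt_dTheta hθ φ)).sub
      ((hg.hasDerivAt_dTheta hθ φ).mul
        ((smoothStrip_sin.mul hf.dTheta).hasDerivAt_dTheta hθ φ))).deriv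
  have h2 : Z (azimuthalFlux c₂ c₁ f g) θ φ = _ :=
    (((((hg.hasDerivAt_Z hθ φ).mul (hf.Z.hasDerivAt_Z hθ φ)).sub
      ((hf.hasDerivAt_Z hθ φ).mul (hg.Z.hasDerivAt_Z hθ φ))).const_mul
        ((Real.sin θ : ℂ) * c₂ θ)).add
      (((hg.hasDerivAt_Z hθ φ).mul (hf.hasDerivAt_Z hθ φ)).const_mul
        ((Real.sin θ : ℂ) * c₁ θ))).deriv
  rw [h1, h2]
  simp only [axisymmetricExpr, Pi.neg_apply]
  field_simp
  ring

/-- The divergence theorem on a rectangle away from the poles, where the coefficients are smooth.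
The sides `φ = 0` and `φ = 2π` cancel by periodicity. -/
theorem integral_divergence_flux (hf : IsTame f) (hg : IsTame g)
    (h₂ : ContDiffOn ℝ ∞ c₂ (Ioo 0 π)) (h₁ : ContDiffOn ℝ ∞ c₁ (Ioo 0 π)) {γ δ : ℝ}
    (hγ : γ ∈ Ioo 0 π) (hδ : δ ∈ Ioo 0 π) :
    (∫ θ in γ..δ, ∫ φ in (0 : ℝ)..2 * π,
      (dTheta (polarFlux f g) θ φ + Z (azimuthalFlux c₂ c₁ f g) θ φ)) =
      (∫ φ in (0 : ℝ)..2 * π, polarFlux f g δ φ) - ∫ φ in (0 : ℝ)..2 * π, polarFlux f g γ φ := by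
  have hA := smoothStrip_polarFlux hf.smooth hg.smooth
  have hB := smoothStrip_azimuthalFlux hf.smooth hg.smooth h₂ h₁
  have hsub : uIcc γ δ ⊆ Ioo 0 π := ordConnected_Ioo.uIcc_subset hγ hδ
  have hsub' : Ioo (min γ δ) (max γ δ) ⊆ Ioo 0 π := Ioo_subset_Icc_self.trans hsub
  have hsq : uIcc γ δ ×ˢ uIcc 0 (2 * π) ⊆ Ioo 0 π ×ˢ univ := prod_mono hsub (subset_univ _)
  have hdiv : ContinuousOn (fun x : ℝ × ℝ => fderiv ℝ (fun x : ℝ × ℝ => polarFlux f g x.1 x.2) x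
      (1, 0) + fderiv ℝ (fun x : ℝ × ℝ => azimuthalFlux c₂ c₁ f g x.1 x.2) x (0, 1))
      (uIcc γ δ ×ˢ uIcc 0 (2 * π)) := by
    refine ((hA.dTheta.add hB.Z).continuousOn.mono hsq).congr fun x hx => ?_
    beta_reduce
    rw [hA.dTheta_eq (hsq hx).1, hB.Z_eq (hsq hx).1]
  have key := integral2_divergence_prod_of_hasFDerivAt
    (fun x : ℝ × ℝ => polarFlux f g x.1 x.2) (fun x : ℝ × ℝ => azimuthalFlux c₂ c₁ f g x.1 x.2)
    (fderiv ℝ fun x : ℝ × ℝ => polarFlux f g x.1 x.2)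
    (fderiv ℝ fun x : ℝ × ℝ => azimuthalFlux c₂ c₁ f g x.1 x.2) γ 0 δ (2 * π)
    (hA.continuousOn.mono hsq) (hB.continuousOn.mono hsq)
    (fun x hx => hA.hasFDerivAt (hsub' hx.1) x.2) (fun x hx => hB.hasFDerivAt (hsub' hx.1) x.2)
    (hdiv.integrableOn_compact (isCompact_uIcc.prod isCompact_uIcc))
  have hper : ∀ θ ∈ uIcc γ δ, azimuthalFlux c₂ c₁ f g θ (2 * π) =
      azimuthalFlux c₂ c₁ f g θ 0 := fun θ hθ => by
    have e1 := hf.periodic θ (hsub hθ) 0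
    have e2 := hg.periodic θ (hsub hθ) 0
    have e3 := hf.Z_periodic (hsub hθ) 0
    have e4 := hg.Z_periodic (hsub hθ) 0
    rw [zero_add] at e1 e2 e3 e4
    simp only [azimuthalFlux, e1, e2, e3, e4]
  simp only at key
  rw [intervalIntegral.integral_congr hper, sub_self, zero_add] at key
  rw [← key]
  refine intervalIntegral.integral_congr fun θ hθ => intervalIntegral.integral_congr fun φ _ => ?_
  rw [hA.dTheta_eq (hsub hθ), hB.Z_eq (hsub hθ)]

/-- The factor `sin θ` in the flux, together with bounds on the functions and their polar
derivatives, is why no boundary term survives at the poles. -/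
theorem exists_bound_integral_polarFlux (hf : IsTame f) (hg : IsTame g) :
    ∃ K, ∀ θ ∈ Ioo 0 π, ‖∫ φ in (0 : ℝ)..2 * π, polarFlux f g θ φ‖ ≤ K * Real.sin θ := by
  obtain ⟨C, hC⟩ := hf.bounded
  obtain ⟨D, hD⟩ := hg.bounded
  refine ⟨2 * (C * D) * (2 * π), fun θ hθ => ?_⟩
  have hs : 0 < Real.sin θ := Real.sin_pos_of_mem_Ioo hθ
  have := intervalIntegral.norm_integral_le_of_norm_le_const (a := 0) (b := 2 * π)
    (f := polarFlux f g θ) (C := 2 * (C * D) * Real.sin θ) fun φ hφ => by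
      rw [uIoc_of_le Real.two_pi_pos.le] at hφ
      obtain ⟨f1, f2⟩ := hC θ hθ φ (Ioc_subset_Icc_self hφ)
      obtain ⟨g1, g2⟩ := hD θ hθ φ (Ioc_subset_Icc_self hφ)
      have hC0 : 0 ≤ C := (norm_nonneg _).trans f1
      have hD0 : 0 ≤ D := (norm_nonneg _).trans g1
      have hsn : ‖(Real.sin θ : ℂ)‖ = Real.sin θ := by
        rw [Complex.norm_real, Real.norm_of_nonneg hs.le]
      calc ‖polarFlux f g θ φ‖ ≤ ‖f θ φ‖ * (Real.sin θ * ‖dTheta g θ φ‖) +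
            ‖g θ φ‖ * (Real.sin θ * ‖dTheta f θ φ‖) := by
            refine (norm_sub_le _ _).trans ?_
            simp only [norm_mul, hsn, le_refl]
        _ ≤ C * (Real.sin θ * D) + D * (Real.sin θ * C) := by gcongr
        _ = _ := by ring
  refine this.trans (le_of_eq ?_)
  rw [sub_zero, abs_of_pos Real.two_pi_pos]
  ring

/-- The integral over the sphere as a limit of integrals over `ε ≤ θ ≤ π - ε`. -/
theorem tendsto_integral_sphere {D : ℝ → ℝ → ℂ}
    (hD : Integrable (fun x : ℝ × ℝ => D x.1 x.2) sphereMeasure) :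
    Filter.Tendsto (fun ε : ℝ => ∫ θ in ε..(π - ε), ∫ φ in (0 : ℝ)..2 * π,
      (Real.sin θ : ℂ) * D θ φ) (nhdsWithin 0 (Ioo 0 (π / 2)))
      (nhds (∫ x, D x.1 x.2 ∂sphereMeasure)) := by
  let I : ℝ → ℂ := fun θ => ∫ φ in (0 : ℝ)..2 * π, (Real.sin θ : ℂ) * D θ φ
  have hI : ∀ θ ∈ Ioo 0 π, (ENNReal.ofReal (Real.sin θ)).toReal •
      ∫ φ in Ioc 0 (2 * π), D θ φ = I θ := fun θ hθ => by
    rw [ENNReal.toReal_ofReal (Real.sin_pos_of_mem_Ioo hθ).le, Complex.real_smul]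
    change _ = ∫ φ in (0 : ℝ)..2 * π, (Real.sin θ : ℂ) * D θ φ
    rw [intervalIntegral.integral_const_mul, intervalIntegral.integral_of_le Real.two_pi_pos.le]
  have hint : IntegrableOn I (Ioo 0 π) := by
    have := (integrable_withDensity_iff_integrable_smul' (by fun_prop) (by simp)).mp
      (Integrable.integral_prod_left hD)
    refine this.congr ?_
    filter_upwards [ae_restrict_mem measurableSet_Ioo] with θ hθ using hI θ hθ
  have hval : ∫ x, D x.1 x.2 ∂sphereMeasure = ∫ θ in (0 : ℝ)..π, I θ := by
    rw [sphereMeasure, integral_prod _ hD,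
      integral_withDensity_eq_integral_toReal_smul (by fun_prop) (by simp),
      intervalIntegral.integral_of_le Real.pi_pos.le,
      integral_Ioc_eq_integral_Ioo (x := (0 : ℝ)) (y := π)]
    refine integral_congr_ae ?_
    filter_upwards [ae_restrict_mem measurableSet_Ioo] with θ hθ using hI θ hθ
  -- Integrability of `I` is known only on `(0, π)`; cutting it off gives a primitive continuous on
  -- all of `ℝ`, so the limit can be evaluated at `ε = 0`.
  have hG : Continuous fun t => ∫ θ in (0 : ℝ)..t, (Ioo 0 π).indicator I θ :=
    Integrable.continuous_primitive ((integrable_indicator_iff measurableSet_Ioo).mpr hint) 0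
  have hind : ∀ t ∈ Icc 0 π, ∫ θ in (0 : ℝ)..t, (Ioo 0 π).indicator I θ =
      ∫ θ in (0 : ℝ)..t, I θ := fun t ht => by
    rw [intervalIntegral.integral_of_le ht.1, intervalIntegral.integral_of_le ht.1,
      integral_Ioc_eq_integral_Ioo, integral_Ioc_eq_integral_Ioo]
    refine setIntegral_congr_fun measurableSet_Ioo fun θ hθ => ?_
    exact indicator_of_mem (Ioo_subset_Ioo_right ht.2 hθ) I
  have hlim : Filter.Tendsto (fun ε : ℝ => (∫ θ in (0 : ℝ)..(π - ε), (Ioo 0 π).indicator I θ) -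
      ∫ θ in (0 : ℝ)..ε, (Ioo 0 π).indicator I θ) (nhdsWithin 0 (Ioo 0 (π / 2)))
      (nhds (∫ θ in (0 : ℝ)..π, I θ)) := by
    have hc : Continuous fun ε : ℝ => (∫ θ in (0 : ℝ)..(π - ε), (Ioo 0 π).indicator I θ) -
      ∫ θ in (0 : ℝ)..ε, (Ioo 0 π).indicator I θ :=
      (hG.comp (continuous_const.sub continuous_id)).sub hG
    have := (hc.tendsto 0).mono_left (nhdsWithin_le_nhds (s := Ioo 0 (π / 2)))
    simpa only [sub_zero, intervalIntegral.integral_same, hind π ⟨Real.pi_pos.le, le_rfl⟩]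
      using this
  rw [hval]
  refine hlim.congr' ?_
  filter_upwards [self_mem_nhdsWithin] with ε hε
  have e1 : ε ∈ Icc 0 π := ⟨hε.1.le, by linarith [hε.2, Real.pi_pos]⟩
  have e2 : π - ε ∈ Icc 0 π := ⟨by linarith [e1.2], by linarith [e1.1]⟩
  rw [hind _ e1, hind _ e2]
  have hii : IntervalIntegrable I volume 0 π :=
    (intervalIntegrable_iff_integrableOn_Ioo_of_le Real.pi_pos.le).mpr hint
  exact intervalIntegral.integral_interval_sub_left
    (hii.mono_set (uIcc_subset_uIcc_left (Icc_subset_uIcc e2)))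
    (hii.mono_set (uIcc_subset_uIcc_left (Icc_subset_uIcc e1)))

/-- Green's identity on the sphere. -/
theorem integral_green (hf : IsTame f) (hg : IsTame g)
    (h₂ : ContDiffOn ℝ ∞ c₂ (Ioo 0 π)) (h₁ : ContDiffOn ℝ ∞ c₁ (Ioo 0 π))
    (hint : Integrable (fun x : ℝ × ℝ => g x.1 x.2 * axisymmetricExpr c₂ c₁ c₀ f x.1 x.2 -
      f x.1 x.2 * axisymmetricExpr c₂ (-c₁) c₀ g x.1 x.2) sphereMeasure) :
    ∫ x, (g x.1 x.2 * axisymmetricExpr c₂ c₁ c₀ f x.1 x.2 -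
      f x.1 x.2 * axisymmetricExpr c₂ (-c₁) c₀ g x.1 x.2) ∂sphereMeasure = 0 := by
  have hpi := Real.pi_pos
  obtain ⟨K, hK⟩ := exists_bound_integral_polarFlux hf hg
  have hlim := tendsto_integral_sphere (D := fun θ φ =>
    g θ φ * axisymmetricExpr c₂ c₁ c₀ f θ φ - f θ φ * axisymmetricExpr c₂ (-c₁) c₀ g θ φ) hint
  have hne : (nhdsWithin (0 : ℝ) (Ioo 0 (π / 2))).NeBot := by
    rw [← mem_closure_iff_nhdsWithin_neBot, closure_Ioo (by positivity)]
    exact ⟨le_rfl, by positivity⟩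
  refine tendsto_nhds_unique hlim ?_
  refine squeeze_zero_norm' (a := fun ε => K * Real.sin (π - ε) + K * Real.sin ε) ?_ ?_
  · filter_upwards [self_mem_nhdsWithin] with ε hε
    have e1 : ε ∈ Ioo 0 π := ⟨hε.1, by linarith [hε.2]⟩
    have e2 : π - ε ∈ Ioo 0 π := ⟨by linarith [e1.2], by linarith [e1.1]⟩
    have hsub : uIcc ε (π - ε) ⊆ Ioo 0 π := ordConnected_Ioo.uIcc_subset e1 e2
    have : (∫ θ in ε..(π - ε), ∫ φ in (0 : ℝ)..2 * π, (Real.sin θ : ℂ) *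
        (g θ φ * axisymmetricExpr c₂ c₁ c₀ f θ φ - f θ φ * axisymmetricExpr c₂ (-c₁) c₀ g θ φ)) =
        (∫ φ in (0 : ℝ)..2 * π, polarFlux f g (π - ε) φ) -
          ∫ φ in (0 : ℝ)..2 * π, polarFlux f g ε φ := by
      rw [← integral_divergence_flux hf hg h₂ h₁ e1 e2]
      refine intervalIntegral.integral_congr fun θ hθ =>
        intervalIntegral.integral_congr fun φ _ => ?_
      exact (divergence_flux hf.smooth hg.smooth (hsub hθ) φ).symm
    rw [this]
    exact (norm_sub_le _ _).trans (add_le_add (hK _ e2) (hK _ e1))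
  · have hc : Continuous fun ε : ℝ => K * Real.sin (π - ε) + K * Real.sin ε := by fun_prop
    have := (hc.tendsto 0).mono_left (nhdsWithin_le_nhds (s := Ioo 0 (π / 2)))
    simpa using this

end Green

/-! ### The differential expression evaluated on a mode. -/

section ModeAction

theorem hasDerivAt_ofReal_sin_half (θ : ℝ) : HasDerivAt (fun t : ℝ => ((Real.sin (t / 2) : ℝ) : ℂ))
    (((Real.cos (θ / 2) : ℝ) : ℂ) / 2) θ := by
  have := ((Real.hasDerivAt_sin (θ / 2)).comp θ ((hasDerivAt_id θ).div_const 2)).ofReal_comp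
  convert! this using 1
  push_cast
  ring

theorem hasDerivAt_ofReal_cos_half (θ : ℝ) : HasDerivAt (fun t : ℝ => ((Real.cos (t / 2) : ℝ) : ℂ))
    (-(((Real.sin (θ / 2) : ℝ) : ℂ) / 2)) θ := by
  have := ((Real.hasDerivAt_cos (θ / 2)).comp θ ((hasDerivAt_id θ).div_const 2)).ofReal_comp
  convert! this using 1
  push_cast
  ring

theorem natCast_mul_pow_pred_mul (n : ℕ) (z : ℂ) : (n : ℂ) * z ^ (n - 1) * z = n * z ^ n := by
  rcases n with _ | n
  · simp
  · rw [Nat.add_sub_cancel, mul_assoc, pow_succ]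

/-- The factor `sin θ` removes all half-angle denominators, so the result is again a mode and the
identity holds for every `θ`. It can therefore be iterated as an equality of functions. -/
theorem sin_mul_dTheta_modeFun (m : ℤ) (P : ℂ[X]) (θ φ : ℝ) :
    (Real.sin θ : ℂ) * dTheta (modeFun m P) θ φ =
      modeFun m (driftPoly m * P - (1 - X ^ 2) * derivative P) θ φ := by
  have hP : HasDerivAt (fun t : ℝ => P.eval ((Real.cos t : ℝ) : ℂ))
      ((derivative P).eval ((Real.cos θ : ℝ) : ℂ) * ((-Real.sin θ : ℝ) : ℂ)) θ :=
    HasDerivAt.comp (h₂ := fun z => P.eval z) θ (P.hasDerivAt ((Real.cos θ : ℝ) : ℂ))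
      (Real.hasDerivAt_cos θ).ofReal_comp
  have hd : dTheta (modeFun m P) θ φ = _ :=
    (((((hasDerivAt_ofReal_sin_half θ).pow (northOrder m)).mul
      ((hasDerivAt_ofReal_cos_half θ).pow (southOrder m))).mul hP).const_mul
      (Complex.exp (Complex.I * m * φ))).deriv
  have h : Real.cos θ = Real.cos (θ / 2) ^ 2 - Real.sin (θ / 2) ^ 2 := by
    rw [← Real.cos_two_mul', mul_div_cancel₀ _ two_ne_zero]
  have h1 : Real.cos (θ / 2) ^ 2 + Real.sin (θ / 2) ^ 2 = 1 := Real.cos_sq_add_sin_sq _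
  have hsin : Real.sin θ = 2 * Real.sin (θ / 2) * Real.cos (θ / 2) := by
    rw [← Real.sin_two_mul, mul_div_cancel₀ _ two_ne_zero]
  have h2 : Real.sin θ ^ 2 = 1 - Real.cos θ ^ 2 := Real.sin_sq _
  have h' : ((Real.cos θ : ℝ) : ℂ) = ((Real.cos (θ / 2) : ℝ) : ℂ) ^ 2 -
      ((Real.sin (θ / 2) : ℝ) : ℂ) ^ 2 := by exact_mod_cast congrArg Complex.ofReal h
  have h1' : ((Real.cos (θ / 2) : ℝ) : ℂ) ^ 2 + ((Real.sin (θ / 2) : ℝ) : ℂ) ^ 2 = 1 := by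
    exact_mod_cast congrArg Complex.ofReal h1
  have hsin' : ((Real.sin θ : ℝ) : ℂ) = 2 * ((Real.sin (θ / 2) : ℝ) : ℂ) *
      ((Real.cos (θ / 2) : ℝ) : ℂ) := by exact_mod_cast congrArg Complex.ofReal hsin
  have h2' : ((Real.sin θ : ℝ) : ℂ) ^ 2 = 1 - ((Real.cos θ : ℝ) : ℂ) ^ 2 := by
    exact_mod_cast congrArg Complex.ofReal h2
  have e1 := natCast_mul_pow_pred_mul (northOrder m) ((Real.sin (θ / 2) : ℝ) : ℂ)
  have e2 := natCast_mul_pow_pred_mul (southOrder m) ((Real.cos (θ / 2) : ℝ) : ℂ)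
  rw [hd]
  simp only [modeFun, driftPoly, eval_sub, eval_mul, eval_add, eval_C, eval_X, eval_one, eval_pow,
    Pi.mul_apply, Pi.pow_apply, Complex.ofReal_neg]
  generalize P.eval ((Real.cos θ : ℝ) : ℂ) = p0
  generalize (derivative P).eval ((Real.cos θ : ℝ) : ℂ) = p1
  generalize Complex.exp (Complex.I * m * φ) = E
  generalize ((Real.cos θ : ℝ) : ℂ) = x at *
  generalize ((Real.sin θ : ℝ) : ℂ) = S at *
  generalize ((Real.sin (θ / 2) : ℝ) : ℂ) = s at *
  generalize ((Real.cos (θ / 2) : ℝ) : ℂ) = c at *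
  generalize northOrder m = n at *
  generalize southOrder m = k at *
  have hc2 : c ^ 2 = (1 + x) / 2 := by linear_combination (h' - h1') * (-1 / 2 : ℂ)
  have hs2 : s ^ 2 = (1 - x) / 2 := by linear_combination (h' + h1') * (1 / 2 : ℂ)
  have t1 : S * ((n : ℂ) * s ^ (n - 1) * (c / 2)) = n * s ^ n * ((1 + x) / 2) := by
    rw [hsin', ← hc2]
    linear_combination c ^ 2 * e1
  have t2 : S * ((k : ℂ) * c ^ (k - 1) * -(s / 2)) = -(k * c ^ k * ((1 - x) / 2)) := by
    rw [hsin', ← hs2]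
    linear_combination -s ^ 2 * e2
  linear_combination E * c ^ k * p0 * t1 + E * s ^ n * p0 * t2 - E * s ^ n * c ^ k * p1 * h2'

theorem Z_modeFun (m : ℤ) (P : ℂ[X]) (θ φ : ℝ) :
    Z (modeFun m P) θ φ = Complex.I * m * modeFun m P θ φ := by
  have h : HasDerivAt (fun t : ℝ => Complex.I * m * (t : ℂ)) (Complex.I * m * 1) φ :=
    (hasDerivAt_id φ).ofReal_comp.const_mul _
  have : Z (modeFun m P) θ φ = _ := (h.cexp.mul_const _).deriv
  rw [this, modeFun]
  ring

/-- Up to sign, `d` and `l` are `1` and `|m|` in some order of size-independent form; these two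
symmetric relations are all that the second-order computation needs, so the case split on `m`
happens only here. -/
theorem exists_driftPoly_eq (m : ℤ) : ∃ d : ℂ, driftPoly m = C d + C (lowestSpin m : ℂ) * X ∧
    d * lowestSpin m = -m ∧ d ^ 2 + (lowestSpin m : ℂ) ^ 2 = m ^ 2 + 1 := by
  have hsum : ((northOrder m : ℂ) + southOrder m) / 2 = lowestSpin m := by
    have : ((northOrder m + southOrder m : ℕ) : ℂ) = ((2 * lowestSpin m : ℕ) : ℂ) :=
      congrArg _ (northOrder_add_southOrder m)
    push_cast at this
    rw [this]
    ring
  have key : ∀ d l : ℤ, ((northOrder m : ℤ) - southOrder m = 2 * d) → ((lowestSpin m : ℤ) = l) →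
      d * l = -m → d ^ 2 + l ^ 2 = m ^ 2 + 1 →
      ∃ d : ℂ, driftPoly m = C d + C (lowestSpin m : ℂ) * X ∧
        d * lowestSpin m = -m ∧ d ^ 2 + (lowestSpin m : ℂ) ^ 2 = m ^ 2 + 1 := by
    intro d l h1 h2 h3 h4
    have h1' : (northOrder m : ℂ) - southOrder m = 2 * d := by exact_mod_cast h1
    have h2' : (lowestSpin m : ℂ) = l := by exact_mod_cast h2
    refine ⟨d, ?_, ?_, ?_⟩
    · rw [driftPoly, hsum, h1', mul_div_cancel_left₀ _ two_ne_zero]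
    · rw [h2']; exact_mod_cast h3
    · rw [h2']; exact_mod_cast h4
  rcases lt_trichotomy m 0 with h | h | h
  · exact key 1 (-m) (by unfold northOrder southOrder; omega) (by unfold lowestSpin; omega)
      (by ring) (by ring)
  · exact key 0 1 (by unfold northOrder southOrder; omega) (by unfold lowestSpin; omega)
      (by simp [h]) (by simp [h])
  · exact key (-1) m (by unfold northOrder southOrder; omega) (by unfold lowestSpin; omega)
      (by ring) (by ring)

theorem horizonExpr_modeFun {M : ℝ} (a : ℝ) (hM : 0 < M) (m : ℤ) (P : ℂ[X]) {θ : ℝ}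
    (hθ : θ ∈ Ioo 0 π) (φ : ℝ) :
    horizonExpr M a (modeFun m P) θ φ = modeFun m (horizonPoly M a m P) θ φ := by
  have hr : rPlus M a ≠ 0 := (hM.trans_le (le_rPlus M a)).ne'
  have hs : (Real.sin θ : ℂ) ≠ 0 := by exact_mod_cast (Real.sin_pos_of_mem_Ioo hθ).ne'
  have hs2 : (Real.sin θ : ℂ) ^ 2 = 1 - (Real.cos θ : ℂ) ^ 2 := by
    exact_mod_cast congrArg Complex.ofReal (Real.sin_sq θ)
  have hfun : (fun t p => (Real.sin t : ℂ) * dTheta (modeFun m P) t p) =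
      modeFun m (driftPoly m * P - (1 - X ^ 2) * derivative P) :=
    funext fun t => funext fun p => sin_mul_dTheta_modeFun m P t p
  have hdd := eq_div_of_mul_eq hs ((mul_comm _ _).trans
    (sin_mul_dTheta_modeFun m (driftPoly m * P - (1 - X ^ 2) * derivative P) θ φ))
  have hZ : Z (modeFun m P) = fun θ φ => Complex.I * m * modeFun m P θ φ :=
    funext fun t => funext fun p => Z_modeFun m P t p
  have hZZ : Z (Z (modeFun m P)) θ φ = (Complex.I * m) ^ 2 * modeFun m P θ φ := by
    have : Z (Z (modeFun m P)) θ φ = Complex.I * m * Z (modeFun m P) θ φ := by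
      refine (congrArg (fun g => Z g θ φ) hZ).trans ?_
      exact deriv_const_mul_field (Complex.I * (m : ℂ)) (v := fun t => modeFun m P θ t)
    rw [this, Z_modeFun]
    ring
  obtain ⟨d, hd, hd1, hd2⟩ := exists_driftPoly_eq m
  rw [horizonExpr, spinLaplacian, hfun, hdd, hZZ, Z_modeFun, horizonPoly_apply]
  simp only [modeFun, eval_add, eval_mul, eval_potentialPoly, laplacianPoly_apply, hd,
    eval_sub, eval_C, eval_X, eval_one, eval_pow, derivative_mul, derivative_add, derivative_sub,
    derivative_C, derivative_X, derivative_one, derivative_X_pow, eval_zero, realPotential,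
    spinRatio, eval_ofNat]
  have hrc : (rPlus M a : ℂ) ≠ 0 := by exact_mod_cast hr
  have hMc : (M : ℂ) ≠ 0 := by exact_mod_cast hM.ne'
  push_cast [-Complex.ofReal_sin, -Complex.ofReal_cos]
  generalize P.eval ((Real.cos θ : ℝ) : ℂ) = p0
  generalize (derivative P).eval ((Real.cos θ : ℝ) : ℂ) = p1
  generalize (derivative (derivative P)).eval ((Real.cos θ : ℝ) : ℂ) = p2
  generalize Complex.exp (Complex.I * m * φ) = E
  generalize (((Real.sin (θ / 2) : ℝ) : ℂ) ^ northOrder m *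
    ((Real.cos (θ / 2) : ℝ) : ℂ) ^ southOrder m) = F
  generalize ((Real.cos θ : ℝ) : ℂ) = x at *
  generalize ((Real.sin θ : ℝ) : ℂ) = S at *
  generalize (lowestSpin m : ℂ) = l at *
  generalize (rPlus M a : ℂ) = r at *
  generalize (M : ℂ) = μ at *
  generalize (m : ℂ) = n at *
  generalize (a : ℂ) = b at *
  set K := (d + l * x) * ((d + l * x) * p0 - (1 - x ^ 2) * p1) -
    (1 - x ^ 2) * ((0 + (0 * x + l * 1)) * p0 + (d + l * x) * p1 -
      ((0 - 2 * x ^ 1) * p1 + (1 - x ^ 2) * p2)) with hK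
  set Λ := l * (l + 1) * p0 + 2 * (d + l * x) * p1 -
    ((0 - 2 * x ^ 1) * p1 + (1 - x ^ 2) * p2) with hΛ
  -- `K` is `(sin θ ∂_θ)²` on the mode. The singular terms `m²`, `-2 m cos θ` and `cos² θ` over
  -- `sin² θ` combine to `(m - x)²/sin² θ`, which cancels the nonpolynomial part of `-K/sin² θ`.
  have hL : K = (n - x) ^ 2 * p0 - S ^ 2 * (Λ - p0) := by
    rw [hK, hΛ]
    linear_combination p0 * hd2 + 2 * x * p0 * hd1 +
      (l * (l + 1) * p0 + 2 * (d + l * x) * p1 -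
        ((0 - 2 * x ^ 1) * p1 + (1 - x ^ 2) * p2) - p0) * hs2
  clear_value K Λ
  rw [hL, ← hs2]
  field_simp
  ring_nf
  rw [Complex.I_sq]
  ring

end ModeAction

/-! ### Smoothness of the modes across both poles. -/

section ModeSmooth

/-- The smooth function `|z|^|k| e^{i k arg z}`. -/
def spinPow (k : ℤ) (z : ℂ) : ℂ :=
  if 0 ≤ k then z ^ k.natAbs else (starRingEnd ℂ) z ^ k.natAbs

theorem contDiff_spinPow (k : ℤ) : ContDiff ℝ ∞ (spinPow k) := by
  unfold spinPow
  split_ifs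
  · exact contDiff_id.pow _
  · exact Complex.conjCLE.contDiff.pow _

theorem spinPow_polar (k : ℤ) (r φ : ℝ) : spinPow k ((r : ℂ) * Complex.exp (Complex.I * φ)) =
    (r : ℂ) ^ k.natAbs * Complex.exp (Complex.I * k * φ) := by
  unfold spinPow
  split_ifs with h
  · rw [mul_pow, ← Complex.exp_nat_mul]
    congr 2
    have : ((k.natAbs : ℤ) : ℂ) = k := by rw [Int.natAbs_of_nonneg h]
    rw [Int.cast_natCast] at this
    rw [this]
    ring
  · rw [map_mul, mul_pow, ← Complex.exp_conj, ← Complex.exp_nat_mul, Complex.conj_ofReal, map_mul,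
      Complex.conj_I, Complex.conj_ofReal]
    congr 2
    have : ((k.natAbs : ℤ) : ℂ) = -k := by
      rw [Int.ofNat_natAbs_of_nonpos (by omega)]; push_cast; ring
    rw [Int.cast_natCast] at this
    rw [this]
    ring

/-- The expression of a mode in a stereographic coordinate. -/
def stereoMode (k : ℤ) (l : ℕ) (ε : ℝ) (P : ℂ[X]) (z : ℂ) : ℂ :=
  spinPow k z * (((1 + ‖z‖ ^ 2)⁻¹ : ℝ) : ℂ) ^ l *
    P.eval ((ε * (1 - ‖z‖ ^ 2) * (1 + ‖z‖ ^ 2)⁻¹ : ℝ) : ℂ)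

theorem contDiff_stereoMode (k : ℤ) (l : ℕ) (ε : ℝ) (P : ℂ[X]) :
    ContDiff ℝ ∞ (stereoMode k l ε P) := by
  have hn : ContDiff ℝ ∞ fun z : ℂ => ‖z‖ ^ 2 := contDiff_norm_sq ℝ
  have hi : ContDiff ℝ ∞ fun z : ℂ => (1 + ‖z‖ ^ 2)⁻¹ :=
    (contDiff_const.add hn).inv fun z => by positivity
  have hP : ContDiff ℝ ∞ fun z : ℂ => P.eval z := by
    have := (P.contDiff_aeval (𝕜 := ℂ) ∞).restrict_scalars ℝ
    simpa only [coe_aeval_eq_eval] using this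
  exact ((contDiff_spinPow k).mul ((contDiff_ofReal.comp hi).pow l)).mul
    (hP.comp (contDiff_ofReal.comp ((contDiff_const.mul (contDiff_const.sub hn)).mul hi)))

/-- With `|z| = s/c` one has `(1 + |z|²)⁻¹ = c²`, so `s^|k| c^j = |z|^|k| (c²)^l` exactly when `|k|
+ j = 2l`. Exchanging `s` and `c` and taking `ε = -1` gives the chart at the south pole. -/
theorem stereoMode_polar (k : ℤ) (l j : ℕ) (hl : k.natAbs + j = 2 * l) (ε : ℝ) (P : ℂ[X])
    {s c : ℝ} (hc : c ≠ 0) (h1 : c ^ 2 + s ^ 2 = 1) (φ : ℝ) :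
    stereoMode k l ε P (((s / c : ℝ) : ℂ) * Complex.exp (Complex.I * φ)) =
      Complex.exp (Complex.I * k * φ) * ((s : ℂ) ^ k.natAbs * (c : ℂ) ^ j *
        P.eval ((ε * (c ^ 2 - s ^ 2) : ℝ) : ℂ)) := by
  have hnorm : ‖((s / c : ℝ) : ℂ) * Complex.exp (Complex.I * φ)‖ ^ 2 = (s / c) ^ 2 := by
    have := norm_exp_mode 1 φ
    rw [Int.cast_one, mul_one] at this
    rw [norm_mul, this, mul_one, Complex.norm_real, Real.norm_eq_abs, sq_abs]
  have hinv : (1 + (s / c) ^ 2)⁻¹ = c ^ 2 := by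
    have : 1 + (s / c) ^ 2 = (c ^ 2)⁻¹ := by
      field_simp
      exact h1
    rw [this, inv_inv]
  have hcos : ε * (1 - (s / c) ^ 2) * c ^ 2 = ε * (c ^ 2 - s ^ 2) := by
    field_simp
  rw [stereoMode, hnorm, hinv, hcos, spinPow_polar]
  have hcc : (c : ℂ) ≠ 0 := by exact_mod_cast hc
  have : ((c ^ 2 : ℝ) : ℂ) ^ l = (c : ℂ) ^ k.natAbs * (c : ℂ) ^ j := by
    rw [← pow_add, hl, pow_mul]
    push_cast
    rfl
  rw [this]
  push_cast
  rw [div_pow]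
  field_simp

theorem isSmoothSpinWeighted_modeFun (m : ℤ) (P : ℂ[X]) :
    IsSmoothSpinWeighted (-1) (modeFun m P) := by
  refine ⟨stereoMode (m - 1) (lowestSpin m) 1 P, stereoMode (m + 1) (lowestSpin m) (-1) P,
    contDiff_stereoMode _ _ _ _, contDiff_stereoMode _ _ _ _, fun θ hθ φ => ?_⟩
  have hs : Real.sin (θ / 2) ≠ 0 :=
    (Real.sin_pos_of_mem_Ioo ⟨by linarith [hθ.1], by linarith [hθ.2, Real.pi_pos]⟩).ne'
  have hc : Real.cos (θ / 2) ≠ 0 :=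
    (Real.cos_pos_of_mem_Ioo ⟨by linarith [hθ.1, Real.pi_pos], by linarith [hθ.2]⟩).ne'
  have h : Real.cos θ = Real.cos (θ / 2) ^ 2 - Real.sin (θ / 2) ^ 2 := by
    rw [← Real.cos_two_mul', mul_div_cancel₀ _ two_ne_zero]
  have hsum := northOrder_add_southOrder m
  constructor
  · rw [Real.tan_eq_sin_div_cos, stereoMode_polar (m - 1) (lowestSpin m) (southOrder m) hsum 1 P hc
      (Real.cos_sq_add_sin_sq _), one_mul, ← h, modeFun, ← mul_assoc, ← Complex.exp_add]
    congr 2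
    push_cast
    ring
  · rw [← Complex.ofReal_inv, Real.tan_eq_sin_div_cos, inv_div,
      stereoMode_polar (m + 1) (lowestSpin m) (northOrder m) (by rw [← hsum, add_comm]; rfl) (-1) P
      hs (Real.sin_sq_add_cos_sq _), neg_one_mul, neg_sub, ← h, modeFun, ← mul_assoc,
      ← Complex.exp_add, mul_comm (((Real.cos (θ / 2) : ℝ) : ℂ) ^ _)]
    congr 2
    push_cast
    ring

end ModeSmooth

/-! ### Coefficients, additivity and formal adjoint of the horizon operator. -/

section HorizonExpr

/-- The coefficient of `Z²` in the horizon operator. -/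
def secondCoeff (M a : ℝ) (θ : ℝ) : ℂ :=
  -(1 / (Real.sin θ : ℂ) ^ 2) +
    ((a ^ 2 / (M * rPlus M a) *
      (1 - a ^ 2 / (4 * M * rPlus M a) * Real.sin θ ^ 2) : ℝ) : ℂ)

/-- The coefficient of `Z` in the horizon operator. -/
def firstCoeff (M a : ℝ) (θ : ℝ) : ℂ :=
  2 * Complex.I * ((Real.cos θ : ℂ) / (Real.sin θ : ℂ) ^ 2) +
    ((a / (M * rPlus M a) : ℝ) : ℂ) * ((rPlus M a : ℂ) + Complex.I * a * Real.cos θ)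

/-- The zeroth order coefficient of the horizon operator. -/
def zerothCoeff (θ : ℝ) : ℂ := ((Real.cos θ : ℂ) / (Real.sin θ : ℂ)) ^ 2 + 1

theorem horizonExpr_eq_axisymmetricExpr (M a : ℝ) (f : ℝ → ℝ → ℂ) (θ φ : ℝ) :
    horizonExpr M a f θ φ =
      axisymmetricExpr (secondCoeff M a) (firstCoeff M a) zerothCoeff f θ φ := by
  rw [horizonExpr, spinLaplacian, axisymmetricExpr, secondCoeff, firstCoeff, zerothCoeff]
  push_cast
  ring

theorem contDiffOn_inv_sin : ContDiffOn ℝ ∞ (fun θ : ℝ => (Real.sin θ : ℂ)⁻¹) (Ioo 0 π) :=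
  contDiff_ofReal_sin.contDiffOn.inv fun θ hθ => by
    exact_mod_cast (Real.sin_pos_of_mem_Ioo hθ).ne'

theorem contDiffOn_secondCoeff (M a : ℝ) : ContDiffOn ℝ ∞ (secondCoeff M a) (Ioo 0 π) := by
  have h1 : ContDiff ℝ ∞ fun θ : ℝ => a ^ 2 / (M * rPlus M a) *
      (1 - a ^ 2 / (4 * M * rPlus M a) * Real.sin θ ^ 2) := by fun_prop
  refine ((contDiffOn_inv_sin.pow 2).neg.add (contDiff_ofReal.comp h1).contDiffOn).congr
    fun θ _ => ?_
  simp only [secondCoeff, one_div, inv_pow]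
  rfl

theorem contDiffOn_firstCoeff (M a : ℝ) : ContDiffOn ℝ ∞ (firstCoeff M a) (Ioo 0 π) := by
  have h1 : ContDiffOn ℝ ∞ (fun θ : ℝ => (Real.cos θ : ℂ)) (Ioo 0 π) :=
    (contDiff_ofReal.comp Real.contDiff_cos).contDiffOn
  refine ((contDiffOn_const (c := 2 * Complex.I)).mul (h1.mul (contDiffOn_inv_sin.pow 2))).add
    ((contDiffOn_const (c := ((a / (M * rPlus M a) : ℝ) : ℂ))).mul
      ((contDiffOn_const (c := (rPlus M a : ℂ))).add
        ((contDiffOn_const (c := Complex.I * a)).mul h1))) |>.congr fun θ _ => ?_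
  simp only [firstCoeff, div_eq_mul_inv, inv_pow]

theorem rPlus_neg (M a : ℝ) : rPlus M (-a) = rPlus M a := by
  rw [rPlus, rPlus, neg_sq]

/-- The formal adjoint of the horizon operator is obtained by changing the sign of `a`. -/
theorem conj_horizonExpr_neg (M a : ℝ) {w : ℝ → ℝ → ℂ} (hw : SmoothStrip 0 π w) {θ : ℝ}
    (hθ : θ ∈ Ioo 0 π) (φ : ℝ) :
    (starRingEnd ℂ) (horizonExpr M (-a) w θ φ) =
      axisymmetricExpr (secondCoeff M a) (-firstCoeff M a) zerothCoeff
        (fun θ φ => (starRingEnd ℂ) (w θ φ)) θ φ := by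
  have h1 : dTheta (fun t p => (Real.sin t : ℂ) * dTheta (fun θ φ => (starRingEnd ℂ) (w θ φ)) t p)
      θ φ = (starRingEnd ℂ) (dTheta (fun t p => (Real.sin t : ℂ) * dTheta w t p) θ φ) := by
    rw [← dTheta_conj (smoothStrip_sin.mul hw.dTheta) hθ]
    refine dTheta_congr (fun t ht p => ?_) hθ φ
    rw [dTheta_conj hw ht, map_mul, Complex.conj_ofReal]
  have h2 : Z (fun θ φ => (starRingEnd ℂ) (w θ φ)) θ φ = (starRingEnd ℂ) (Z w θ φ) :=
    Z_conj hw hθ φ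
  have h3 : Z (Z (fun θ φ => (starRingEnd ℂ) (w θ φ))) θ φ = (starRingEnd ℂ) (Z (Z w) θ φ) := by
    rw [← Z_conj hw.Z hθ]
    exact congrArg (fun g : ℝ → ℂ => deriv g φ) (funext fun p => Z_conj hw hθ p)
  rw [horizonExpr_eq_axisymmetricExpr, axisymmetricExpr, axisymmetricExpr, h1, h2, h3]
  simp only [secondCoeff, firstCoeff, zerothCoeff, rPlus_neg, map_add, map_mul, map_neg, map_pow,
    map_div₀, map_one, map_ofNat, Complex.conj_ofReal, Complex.conj_I, Pi.neg_apply, neg_sq]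
  push_cast
  ring

theorem horizonExpr_add (M a : ℝ) {f g : ℝ → ℝ → ℂ} (hf : SmoothStrip 0 π f)
    (hg : SmoothStrip 0 π g) {θ : ℝ} (hθ : θ ∈ Ioo 0 π) (φ : ℝ) :
    horizonExpr M a (fun θ φ => f θ φ + g θ φ) θ φ =
      horizonExpr M a f θ φ + horizonExpr M a g θ φ := by
  have hd : ∀ {u v : ℝ → ℝ → ℂ}, SmoothStrip 0 π u → SmoothStrip 0 π v → ∀ t ∈ Ioo 0 π, ∀ p,
      dTheta (fun θ φ => u θ φ + v θ φ) t p = dTheta u t p + dTheta v t p := fun hu hv t ht p =>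
    ((hu.hasDerivAt_dTheta ht p).add (hv.hasDerivAt_dTheta ht p)).deriv
  have hz : ∀ {u v : ℝ → ℝ → ℂ}, SmoothStrip 0 π u → SmoothStrip 0 π v → ∀ p,
      Z (fun θ φ => u θ φ + v θ φ) θ p = Z u θ p + Z v θ p := fun hu hv p =>
    ((hu.hasDerivAt_Z hθ p).add (hv.hasDerivAt_Z hθ p)).deriv
  have h1 : dTheta (fun t p => (Real.sin t : ℂ) * dTheta (fun θ φ => f θ φ + g θ φ) t p) θ φ =
      dTheta (fun t p => (Real.sin t : ℂ) * dTheta f t p) θ φ +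
        dTheta (fun t p => (Real.sin t : ℂ) * dTheta g t p) θ φ := by
    rw [← hd (smoothStrip_sin.mul hf.dTheta) (smoothStrip_sin.mul hg.dTheta) θ hθ]
    refine dTheta_congr (fun t ht p => ?_) hθ φ
    rw [hd hf hg t ht, mul_add]
  have h2 : Z (Z (fun θ φ => f θ φ + g θ φ)) θ φ = Z (Z f) θ φ + Z (Z g) θ φ := by
    rw [← hz hf.Z hg.Z]
    exact congrArg (fun u : ℝ → ℂ => deriv u φ) (funext fun p => hz hf hg p)
  simp only [horizonExpr_eq_axisymmetricExpr, axisymmetricExpr, h1, h2, hz hf hg]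
  ring

theorem IsSmoothSpinWeighted.add {s : ℤ} {f g : ℝ → ℝ → ℂ} (hf : IsSmoothSpinWeighted s f)
    (hg : IsSmoothSpinWeighted s g) : IsSmoothSpinWeighted s fun θ φ => f θ φ + g θ φ := by
  obtain ⟨fN, fS, hfN, hfS, hf⟩ := hf
  obtain ⟨gN, gS, hgN, hgS, hg⟩ := hg
  refine ⟨fun z => fN z + gN z, fun z => fS z + gS z, hfN.add hgN, hfS.add hgS, fun θ hθ φ => ?_⟩
  rw [mul_add, mul_add, (hf θ hθ φ).1, (hf θ hθ φ).2, (hg θ hθ φ).1, (hg θ hθ φ).2]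
  exact ⟨rfl, rfl⟩

end HorizonExpr

/-! ### The closed graph and its bounded inverse. -/

section Graph

variable {M a : ℝ}

theorem add_mem_smoothGraph {p q : SphereL2 × SphereL2} (hp : p ∈ smoothGraph M a)
    (hq : q ∈ smoothGraph M a) : p + q ∈ smoothGraph M a := by
  obtain ⟨f, hf, hf1, hf2⟩ := hp
  obtain ⟨g, hg, hg1, hg2⟩ := hq
  refine ⟨fun θ φ => f θ φ + g θ φ, hf.add hg, ?_, ?_⟩
  · filter_upwards [Lp.coeFn_add p.1 q.1, hf1, hg1] with x h h1 h2
    rw [Prod.fst_add, h, Pi.add_apply, h1, h2]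
  · filter_upwards [Lp.coeFn_add p.2 q.2, hf2, hg2, ae_sphere_mem] with x h h1 h2 hx
    rw [Prod.snd_add, h, Pi.add_apply, h1, h2,
      horizonExpr_add M a hf.isTame.smooth hg.isTame.smooth hx.1]

theorem coeFn_modeL2_horizonPoly (hM : 0 < M) (a : ℝ) (m : ℤ) (P : ℂ[X]) :
    modeL2 m (horizonPoly M a m P) =ᵐ[sphereMeasure]
      fun x => horizonExpr M a (modeFun m P) x.1 x.2 := by
  filter_upwards [coeFn_modeL2 m (horizonPoly M a m P), ae_sphere_mem] with x h hx
  rw [h, horizonExpr_modeFun a hM m P hx.1]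

theorem modeL2_mem_smoothGraph (hM : 0 < M) (m : ℤ) (P : ℂ[X]) :
    (modeL2 m P, modeL2 m (horizonPoly M a m P)) ∈ smoothGraph M a :=
  ⟨modeFun m P, isSmoothSpinWeighted_modeFun m P, coeFn_modeL2 m P,
    coeFn_modeL2_horizonPoly hM a m P⟩

/-- Green's identity for `f` and the conjugate of a mode. The integrand is integrable as a
difference of pairings of `L²` elements, so the singular coefficients need no estimate at the poles.
-/
theorem inner_modeL2_of_mem_smoothGraph (hM : 0 < M) {p : SphereL2 × SphereL2}
    (hp : p ∈ smoothGraph M a) (m : ℤ) (P : ℂ[X]) :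
    inner ℂ (modeL2 m P) p.2 = inner ℂ (modeL2 m (horizonPoly M (-a) m P)) p.1 := by
  obtain ⟨f, hf, hf1, hf2⟩ := hp
  have hw := (isSmoothSpinWeighted_modeFun m P).isTame
  have i1 := L2.integrable_inner (𝕜 := ℂ) (modeL2 m P) p.2
  have i2 := L2.integrable_inner (𝕜 := ℂ) (modeL2 m (horizonPoly M (-a) m P)) p.1
  have hae : (fun x => inner ℂ (modeL2 m P x) (p.2 x) -
      inner ℂ (modeL2 m (horizonPoly M (-a) m P) x) (p.1 x)) =ᵐ[sphereMeasure]
      fun x : ℝ × ℝ => (starRingEnd ℂ) (modeFun m P x.1 x.2) *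
          axisymmetricExpr (secondCoeff M a) (firstCoeff M a) zerothCoeff f x.1 x.2 -
        f x.1 x.2 * axisymmetricExpr (secondCoeff M a) (-firstCoeff M a) zerothCoeff
          (fun θ φ => (starRingEnd ℂ) (modeFun m P θ φ)) x.1 x.2 := by
    filter_upwards [hf1, hf2, coeFn_modeL2 m P, coeFn_modeL2_horizonPoly hM (-a) m P,
      ae_sphere_mem] with x h1 h2 h3 h4 hx
    rw [h1, h2, h3, h4, RCLike.inner_apply, RCLike.inner_apply,
      conj_horizonExpr_neg M a hw.smooth hx.1, horizonExpr_eq_axisymmetricExpr, mul_comm]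
  have hzero := integral_green (c₀ := zerothCoeff) hf.isTame hw.conj (contDiffOn_secondCoeff M a)
    (contDiffOn_firstCoeff M a) ((i1.sub i2).congr hae)
  rw [← integral_congr_ae hae, integral_sub i1 i2] at hzero
  rw [L2.inner_def, L2.inner_def]
  exact sub_eq_zero.mp hzero

/-- The weak equation is a closed condition on the pair, so it survives passage to the closure. -/
theorem inner_modeL2_of_mem_horizonGraph (hM : 0 < M) {p : SphereL2 × SphereL2}
    (hp : p ∈ horizonGraph M a) (m : ℤ) (P : ℂ[X]) :
    inner ℂ (modeL2 m P) p.2 = inner ℂ (modeL2 m (horizonPoly M (-a) m P)) p.1 := by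
  have hclosed : IsClosed {p : SphereL2 × SphereL2 |
      inner ℂ (modeL2 m P) p.2 = inner ℂ (modeL2 m (horizonPoly M (-a) m P)) p.1} :=
    isClosed_eq (by fun_prop) (by fun_prop)
  exact closure_minimal (fun q hq => inner_modeL2_of_mem_smoothGraph hM hq m P) hclosed hp

theorem eq_zero_of_inner_modeL2_horizonPoly_eq_zero (hM : 0 < M) (v : SphereL2)
    (hv : ∀ m P, inner ℂ (modeL2 m (horizonPoly M a m P)) v = 0) : v = 0 :=
  eq_zero_of_inner_modeL2_eq_zero v fun m P => inner_modeL2_eq_zero hM m v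
    (fun Q => inner_eq_zero_symm.mp (hv m Q)) P

/-- Finite sums of modes, as elements of `L²(dΩ)`. -/
def modeSum : (ℤ →₀ ℂ[X]) →ₗ[ℂ] SphereL2 := Finsupp.lsum ℂ modeL2

/-- The horizon operator on finite sums of modes. -/
def horizonSum (M a : ℝ) : (ℤ →₀ ℂ[X]) →ₗ[ℂ] SphereL2 :=
  Finsupp.lsum ℂ fun m => (modeL2 m).comp (horizonPoly M a m)

theorem modeSum_mem_smoothGraph (hM : 0 < M) (v : ℤ →₀ ℂ[X]) :
    (modeSum v, horizonSum M a v) ∈ smoothGraph M a := by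
  induction v using Finsupp.induction_linear with
  | zero => simpa using modeL2_mem_smoothGraph (a := a) hM 0 0
  | add v w hv hw =>
    rw [map_add, map_add]
    exact add_mem_smoothGraph hv hw
  | single m P => simpa [modeSum, horizonSum] using modeL2_mem_smoothGraph (a := a) hM m P

theorem norm_sum_modeL2_sq (s : Finset ℤ) (P : ℤ → ℂ[X]) :
    ‖∑ m ∈ s, modeL2 m (P m)‖ ^ 2 = ∑ m ∈ s, ‖modeL2 m (P m)‖ ^ 2 := by
  induction s using Finset.induction_on with
  | empty => simp
  | insert m s hm ih =>
    rw [Finset.sum_insert hm, Finset.sum_insert hm, ← ih, sq, sq, sq]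
    refine norm_add_sq_eq_norm_sq_add_norm_sq_of_inner_eq_zero (𝕜 := ℂ) _ _ ?_
    rw [inner_sum]
    refine Finset.sum_eq_zero fun n hn => inner_modeL2_of_ne ?_ _ _
    rintro rfl
    exact hm hn

/-- The form bounds of different modes cannot be added, since they may concern real parts in one
mode and imaginary parts of either sign in another. The norm bounds can, by Pythagoras. -/
theorem norm_modeSum_le (hM : 0 < M) (v : ℤ →₀ ℂ[X]) :
    ‖modeSum v‖ ≤ 2 * ‖horizonSum M a v‖ := by
  have h1 : modeSum v = ∑ m ∈ v.support, modeL2 m (v m) := rfl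
  have h2 : horizonSum M a v = ∑ m ∈ v.support, modeL2 m (horizonPoly M a m (v m)) := rfl
  refine le_of_sq_le_sq ?_ (by positivity)
  rw [mul_pow, h1, h2, norm_sum_modeL2_sq,
    norm_sum_modeL2_sq v.support fun m => horizonPoly M a m (v m), Finset.mul_sum]
  refine Finset.sum_le_sum fun m _ => ?_
  rw [← mul_pow]
  gcongr
  have := norm_le_of_form_bound (modeL2 m) (horizonPoly M a m) (1 / 2)
    (horizonPoly_form_bound hM m) (v m)
  linarith

theorem denseRange_horizonSum (hM : 0 < M) : DenseRange (horizonSum M a) := by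
  have : (LinearMap.range (horizonSum M a))ᗮ = ⊥ := by
    rw [Submodule.eq_bot_iff]
    intro v hv
    refine eq_zero_of_inner_modeL2_horizonPoly_eq_zero (a := a) hM v fun m P => ?_
    have := (Submodule.mem_orthogonal _ _).mp hv _ (LinearMap.mem_range_self _ (Finsupp.single m P))
    simpa [horizonSum] using this
  have h := Submodule.dense_iff_topologicalClosure_eq_top.mpr
    (Submodule.topologicalClosure_eq_top_iff.mpr this)
  rwa [LinearMap.coe_range] at h

/-- The horizon graph is the graph of the inverse of a bounded operator of norm at most `2`. -/
theorem exists_horizonGraph_inverse (hM : 0 < M) :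
    ∃ R : SphereL2 →L[ℂ] SphereL2, ‖R‖ ≤ 2 ∧
      ∀ u h : SphereL2, (u, h) ∈ horizonGraph M a ↔ u = R h := by
  obtain ⟨R, hR, -, hgraph⟩ := exists_bounded_inverse modeSum (horizonSum M a) 2 zero_le_two
    (norm_modeSum_le hM) (denseRange_horizonSum hM)
  have hmem : ∀ h, (R h, h) ∈ horizonGraph M a := fun h =>
    closure_mono (range_subset_iff.mpr (modeSum_mem_smoothGraph hM)) (hgraph h)
  refine ⟨R, hR, fun u h => ⟨fun huh => sub_eq_zero.mp ?_, fun huh => huh ▸ hmem h⟩⟩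
  -- Both `(u, h)` and `(R h, h)` solve the weak equation with the same `h`, so `u - R h` is
  -- orthogonal to the range of the adjoint operator. The coercivity and Galerkin argument with `-a`
  -- in place of `a` makes it zero.
  refine eq_zero_of_inner_modeL2_horizonPoly_eq_zero (a := -a) hM _ fun m P => ?_
  rw [inner_sub_right, sub_eq_zero]
  exact (inner_modeL2_of_mem_horizonGraph hM huh m P).symm.trans
    (inner_modeL2_of_mem_horizonGraph hM (hmem h) m P)

/-- The horizon graph is single-valued. -/
theorem horizonGraph_unique (hM : 0 < M) {u h₁ h₂ : SphereL2} (hu₁ : (u, h₁) ∈ horizonGraph M a)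
    (hu₂ : (u, h₂) ∈ horizonGraph M a) : h₁ = h₂ := by
  refine sub_eq_zero.mp (eq_zero_of_inner_modeL2_eq_zero _ fun m P => inner_eq_zero_symm.mp ?_)
  rw [inner_sub_right, sub_eq_zero]
  exact (inner_modeL2_of_mem_horizonGraph hM hu₁ m P).trans
    (inner_modeL2_of_mem_horizonGraph hM hu₂ m P).symm

end Graph

end

end KerrHorizon

/-- The horizon spin `-1` angular operator is a well-defined (single-valued) closed operator on
`L²(dΩ)`; it is invertible, with an everywhere defined inverse of norm at most `2`; and its
eigenvalues have modulus at least `1/2`, for all `|a| ≤ M`. -/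
theorem lemma6p8 (M a : ℝ) (hM : 0 < M) (ha : |a| ≤ M) :
    (∀ u h₁ h₂ : KerrHorizon.SphereL2, (u, h₁) ∈ KerrHorizon.horizonGraph M a →
      (u, h₂) ∈ KerrHorizon.horizonGraph M a → h₁ = h₂) ∧
    (∃ R : KerrHorizon.SphereL2 →L[ℂ] KerrHorizon.SphereL2, ‖R‖ ≤ 2 ∧
      ∀ u h : KerrHorizon.SphereL2, (u, h) ∈ KerrHorizon.horizonGraph M a ↔ u = R h) ∧
    (∀ (ev : ℂ) (u : KerrHorizon.SphereL2), u ≠ 0 →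
      (u, ev • u) ∈ KerrHorizon.horizonGraph M a → 1 / 2 ≤ ‖ev‖) := by
  obtain ⟨R, hR, hgraph⟩ := KerrHorizon.exists_horizonGraph_inverse (a := a) hM
  refine ⟨fun u h₁ h₂ => KerrHorizon.horizonGraph_unique hM, ⟨R, hR, hgraph⟩, fun ev u hu hev => ?_⟩
  have h1 : ‖u‖ ≤ 2 * (‖ev‖ * ‖u‖) := by
    calc ‖u‖ = ‖R (ev • u)‖ := congrArg _ ((hgraph _ _).mp hev)
      _ ≤ ‖R‖ * ‖ev • u‖ := R.le_opNorm _
      _ ≤ 2 * (‖ev‖ * ‖u‖) := by rw [norm_smul]; gcongr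
  have h2 : 0 < ‖u‖ := norm_pos_iff.mpr hu
  nlinarith
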